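/- Let $0<r<1$ and let $f_r(z)=\dfrac{\operatorname{Log}(1+rz)}{\operatorname{Log}(1+z)}$ for $z\in\mathbb C\setminus(-\infty,-1]$, where $\operatorname{Log}$ is the principal branch of the logarithm and $f_r(0)=r$ (the removable singularity at $z=0$ is removed). Define, for $t>1$, $$\sigma_r(t)=\begin{cases}\dfrac{-\log(1-rt)}{t\,(\log^2(t-1)+\pi^2)}, & 1<t<1/r,\\[2mm] \infty, & t=1/r,\\[1mm] \dfrac{\log\big((t-1)/(rt-1)\big)}{t\,(\log^2(t-1)+\pi^2)}, & t>1/r.\end{cases}$$ A Bernstein function is a $C^\infty$ function $f:(0,\infty)\to[0,\infty)$ with $(-1)^{n-1}f^{(n)}\ge 0$ for all $n\ge1$; it is a complete Bernstein function if $f(x)=a+bx+\int_0^\infty(1-e^{-xs})m(s)\,ds$ for $x>0$, where $a,b\ge0$ and $m$ is completely monotone on $(0,\infty)$ with $\int_0^\infty\min(1,s)m(s)\,ds<\infty$. A Stieltjes function is a function $f:(0,\infty)\to[0,\infty)$ of the form $f(x)=c+\int_{[0,\infty)}\frac{d\mu(t)}{x+t}$ with $c\ge0$ and $\mu$ a positive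 measure on $[0,\infty)$ such that the integral converges for all $x>0$. Then $\sigma_r\ge 0$ on $(1,\infty)$, all integrals below converge absolutely, and the following hold. 1. $f_r$ is (on $(0,\infty)$) a complete Bernstein function, and for all $z\in\mathbb C\setminus(-\infty,-1]$ $$f_r(z)=r+\int_1^\infty\frac{z}{z+t}\,\sigma_r(t)\,dt.$$ 2. On $(-1,\infty)$ the function $f_r$ is strictly concave and strictly increasing, with $\lim_{x\to-1^+}f_r(x)=0$ and $\lim_{x\to\infty}f_r(x)=1$. 3. $1-f_r$ is (on $(0,\infty)$) a Stieltjes function, and for all $z\in\mathbb C\setminus(-\infty,-1]$ $$1-f_r(z)=\int_1^\infty\frac{t\,\sigma_r(t)}{z+t}\,dt.$$ 4. $f_r(z)/z$ is (on $(0,\infty)$) a Stieltjes function, and for all $z\in\mathbb C\setminus(-\infty,-1]$, $z\ne0$, $$\frac{f_r(z)}{z}=\int_{[0,\infty)}\frac{d\mu_r(t)}{z+t},\qquad \mu_r=r\delta_0+1_{(1,\infty)}(t)\,\sigma_r(t)\,dt,$$ where $\delta_0$ is the Dirac measure at $0$. 5. $\sigma_r(t)\to0$ as $t\to1^+$ and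 as $t\to\infty$, and $$\int_1^\infty\sigma_r(t)\,dt=1-r,\qquad \int_1^\infty\frac{\sigma_r(t)}{1+t^2}\,dt=\frac{\log 2\,\log(1+r^2)+\pi\arctan r}{\log^2 2+\pi^2/4}-r.$$ -/

import Mathlib

open MeasureTheory Set Filter Topology
open scoped ContDiff

noncomputable section

/-- Completely monotone functions on `(0,∞)`. -/
def IsCompletelyMonotone (m : ℝ → ℝ) : Prop :=
  ContDiffOn ℝ ∞ m (Ioi 0) ∧
    ∀ n : ℕ, ∀ x : ℝ, 0 < x → 0 ≤ (-1 : ℝ) ^ n * iteratedDeriv n m x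

/-- Bernstein functions: smooth functions `(0,∞) → [0,∞)` with
`(-1)^(n-1) f^(n) ≥ 0` on `(0,∞)` for all `n ≥ 1`. -/
def IsBernstein (f : ℝ → ℝ) : Prop :=
  ContDiffOn ℝ ∞ f (Ioi 0) ∧ (∀ x : ℝ, 0 < x → 0 ≤ f x) ∧
    ∀ n : ℕ, 1 ≤ n → ∀ x : ℝ, 0 < x → 0 ≤ (-1 : ℝ) ^ (n - 1) * iteratedDeriv n f x

/-- Complete Bernstein functions: Bernstein functions whose Lévy measure, in the
Lévy–Khintchine representation `f x = a + b x + ∫ (1 - exp (-x s)) ν(ds)`,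
has a completely monotone density `m` with respect to Lebesgue measure. -/
def IsCompleteBernstein (f : ℝ → ℝ) : Prop :=
  IsBernstein f ∧
    ∃ (a b : ℝ) (m : ℝ → ℝ), 0 ≤ a ∧ 0 ≤ b ∧ IsCompletelyMonotone m ∧
      IntegrableOn (fun s => min 1 s * m s) (Ioi 0) ∧
      ∀ x : ℝ, 0 < x → f x = a + b * x + ∫ s in Ioi (0 : ℝ), (1 - Real.exp (-(x * s))) * m s

/-- Stieltjes functions: `f : (0,∞) → [0,∞)` of the form `f x = c + ∫_{[0,∞)} dμ(t) / (x + t)`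
with `c ≥ 0` and a positive measure `μ` on `[0,∞)` for which the integral converges for `x > 0`.
(Only the part of `μ` on `[0,∞)` enters.) -/
def IsStieltjes (f : ℝ → ℝ) : Prop :=
  ∃ (c : ℝ) (μ : Measure ℝ), 0 ≤ c ∧
    ∀ x : ℝ, 0 < x → IntegrableOn (fun t => 1 / (x + t)) (Ici 0) μ ∧
      f x = c + ∫ t in Ici (0 : ℝ), 1 / (x + t) ∂μ

/-- The function `log (1 + r x) / log (1 + x)`, with its continuous value `r` at `x = 0`. -/
def fReal (r x : ℝ) : ℝ :=
  if x = 0 then r else Real.log (1 + r * x) / Real.log (1 + x)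

/-- The function `Log (1 + r z) / Log (1 + z)` (principal branch), the removable singularity
at `z = 0` being removed with the value `r`. -/
def fCut (r : ℝ) (z : ℂ) : ℂ :=
  if z = 0 then (r : ℂ) else Complex.log (1 + (r : ℂ) * z) / Complex.log (1 + z)

/-- The cut plane `ℂ ∖ (-∞, -1]`. -/
def cutPlane : Set ℂ := ((fun x : ℝ => (x : ℂ)) '' Iic (-1))ᶜ

/-- The density `σ_r` on `(1,∞)`, with the value `∞` at `t = 1/r`. -/
def sigma (r t : ℝ) : EReal :=
  if t < 1 / r then
    ((-Real.log (1 - r * t) / (t * (Real.log (t - 1) ^ 2 + Real.pi ^ 2)) : ℝ) : EReal)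
  else if t = 1 / r then ⊤
  else ((Real.log ((t - 1) / (r * t - 1)) /
    (t * (Real.log (t - 1) ^ 2 + Real.pi ^ 2)) : ℝ) : EReal)

/-- The measure `r δ₀ + 1_{(1,∞)}(t) σ_r(t) dt`. -/
def muMeasure (r : ℝ) : Measure ℝ :=
  ENNReal.ofReal r • Measure.dirac 0 +
    (volume.restrict (Ioi 1)).withDensity (fun t => (sigma r t).toENNReal)

/-- On `(-1,∞)` the two functions agree. -/
theorem fCut_ofReal {r x : ℝ} (h0 : 0 < r) (h1 : r < 1) (hx : -1 < x) :
    fCut r (x : ℂ) = (fReal r x : ℂ) := by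
  have h2 : 0 ≤ 1 + r * x := by nlinarith
  have h3 : 0 ≤ 1 + x := by linarith
  unfold fCut fReal
  by_cases h : x = 0
  · simp [h]
  · simp only [Complex.ofReal_eq_zero, h, if_false]
    rw [Complex.ofReal_div, Complex.ofReal_log h2, Complex.ofReal_log h3]
    push_cast
    rfl

end

/-! Everything follows from Cauchy's formula on the cut plane. The substitution w = exp ζ - 1 maps
the strip |Im ζ| < π onto the cut plane and turns f_r into Log(1 - r + r exp ζ)/ζ, so the two sides
of the cut become the two edges of the strip. Subtracting f_r(z) from f_r in the Cauchy kernel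
removes its pole, and the integral around a rectangle in the strip vanishes (`stripKernel_contour`).

Let the horizontal sides rise to Im ζ = ±π, then let the rectangle lengthen. The horizontal sides
leave the imaginary part of the boundary value of f_r (`tendsto_stripKernel_horizontal`), the right
side gives 2π(1 - f_r(z)) because f_r tends to 1 at infinity, and the left side gives 0. With t = 1
+ exp x that imaginary part is π t σ_r(t) (`boundaryValue_im`), whence 1 - f_r(z) = ∫ t σ_r(t)/(z +
t) dt (`one_sub_fCut_eq`).

The remaining claims are read off this formula: z = 0 gives integrability and the mass 1 - r, z = i
the second integral, strict monotonicity and convexity of 1/(x + t) give the shape of f_r, and 1/(x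
+ t) = ∫ exp(-(x + t)s) ds gives the Lévy density. -/

/-! ### Analyticity of f_r on the cut plane -/

theorem mem_cutPlane_iff {z : ℂ} : z ∈ cutPlane ↔ 1 + z ∈ Complex.slitPlane := by
  rw [Complex.mem_slitPlane_iff, cutPlane, mem_compl_iff, ← not_iff_not, not_not]
  simp only [mem_image, mem_Iic, Complex.add_re, Complex.one_re, Complex.add_im, Complex.one_im,
    zero_add, not_or, not_lt, not_not]
  constructor
  · rintro ⟨x, hx, rfl⟩
    simp only [Complex.ofReal_re, Complex.ofReal_im, and_true]
    linarith
  · rintro ⟨h1, h2⟩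
    exact ⟨z.re, by linarith, Complex.ext (by simp) (by simp [h2])⟩

theorem isOpen_cutPlane : IsOpen cutPlane := by
  have : cutPlane = (fun z : ℂ => 1 + z) ⁻¹' Complex.slitPlane := by
    ext z; exact mem_cutPlane_iff
  rw [this]
  exact Complex.isOpen_slitPlane.preimage (by fun_prop)

theorem zero_mem_cutPlane : (0 : ℂ) ∈ cutPlane := by simp [mem_cutPlane_iff]

theorem ofReal_mem_cutPlane {x : ℝ} (hx : -1 < x) : (x : ℂ) ∈ cutPlane := by
  rw [mem_cutPlane_iff, Complex.mem_slitPlane_iff]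
  left; simp; linarith

theorem one_add_mul_mem_slitPlane {r : ℝ} (h0 : 0 < r) (h1 : r ≤ 1) {z : ℂ} (hz : z ∈ cutPlane) :
    1 + (r : ℂ) * z ∈ Complex.slitPlane := by
  rw [mem_cutPlane_iff, Complex.mem_slitPlane_iff] at hz
  rw [Complex.mem_slitPlane_iff]
  simp only [Complex.add_re, Complex.one_re, Complex.add_im, Complex.one_im, zero_add,
    Complex.re_ofReal_mul, Complex.im_ofReal_mul] at hz ⊢
  rcases hz with h | h
  · left; nlinarith
  · right; exact mul_ne_zero h0.ne' h

theorem hasDerivAt_log_one_add_mul {r : ℝ} (h0 : 0 < r) (h1 : r ≤ 1) {z : ℂ} (hz : z ∈ cutPlane) :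
    HasDerivAt (fun z : ℂ => Complex.log (1 + (r : ℂ) * z)) (r / (1 + r * z)) z := by
  have h : HasDerivAt (fun z : ℂ => 1 + (r : ℂ) * z) r z := by
    simpa using ((hasDerivAt_id z).const_mul (r : ℂ)).const_add 1
  exact h.clog (one_add_mul_mem_slitPlane h0 h1 hz)

theorem log_one_add_ne_zero {z : ℂ} (hz : z ∈ cutPlane) (h : z ≠ 0) : Complex.log (1 + z) ≠ 0 := by
  intro hl
  have := Complex.exp_log (Complex.slitPlane_ne_zero (mem_cutPlane_iff.1 hz))
  rw [hl, Complex.exp_zero] at this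
  exact h (by linear_combination -this)

/-- Dividing both logarithms by z removes the 0/0 at the origin: the two quotients are analytic
there, with values r and 1. -/
theorem fCut_eq_dslope_div_dslope {r : ℝ} (h0 : 0 < r) (h1 : r < 1) (z : ℂ) :
    fCut r z = dslope (fun z : ℂ => Complex.log (1 + (r : ℂ) * z)) 0 z /
      dslope (fun z : ℂ => Complex.log (1 + ((1 : ℝ) : ℂ) * z)) 0 z := by
  unfold fCut
  split_ifs with h
  · subst h
    rw [dslope_same, dslope_same, (hasDerivAt_log_one_add_mul h0 h1.le zero_mem_cutPlane).deriv,
      (hasDerivAt_log_one_add_mul one_pos le_rfl zero_mem_cutPlane).deriv]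
    simp
  · rw [dslope_of_ne _ h, dslope_of_ne _ h, slope_def_field, slope_def_field]
    simp only [mul_zero, add_zero, Complex.log_one, sub_zero, Complex.ofReal_one, one_mul]
    rw [div_div_div_cancel_right₀ h]

theorem differentiableOn_fCut {r : ℝ} (h0 : 0 < r) (h1 : r < 1) :
    DifferentiableOn ℂ (fCut r) cutPlane := by
  have hmem : cutPlane ∈ 𝓝 (0 : ℂ) := isOpen_cutPlane.mem_nhds zero_mem_cutPlane
  have key : ∀ s : ℝ, 0 < s → s ≤ 1 →
      DifferentiableOn ℂ (dslope (fun z : ℂ => Complex.log (1 + (s : ℂ) * z)) 0) cutPlane :=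
    fun s hs hs' => (Complex.differentiableOn_dslope hmem).2 fun z hz =>
      (hasDerivAt_log_one_add_mul hs hs' hz).differentiableAt.differentiableWithinAt
  refine ((key r h0 h1.le).div (key 1 one_pos le_rfl) ?_).congr
    fun z _ => fCut_eq_dslope_div_dslope h0 h1 z
  intro z hz
  rcases eq_or_ne z 0 with rfl | h
  · rw [dslope_same, (hasDerivAt_log_one_add_mul one_pos le_rfl zero_mem_cutPlane).deriv]
    simp
  · rw [dslope_of_ne _ h, slope_def_field]
    simpa [h] using log_one_add_ne_zero hz h

theorem fCut_conj {r : ℝ} (h0 : 0 < r) (h1 : r < 1) {z : ℂ} (hz : z ∈ cutPlane) :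
    fCut r (starRingEnd ℂ z) = starRingEnd ℂ (fCut r z) := by
  unfold fCut
  split_ifs with h h' h'
  · simp
  · simp at h; exact absurd h h'
  · subst h'; simp at h
  · rw [map_div₀, ← Complex.log_conj _ (Complex.mem_slitPlane_iff_arg.1 (mem_cutPlane_iff.1 hz)).1,
      ← Complex.log_conj _ (Complex.mem_slitPlane_iff_arg.1
        (one_add_mul_mem_slitPlane h0 h1.le hz)).1]
    simp

/-! ### Exponential coordinates and the contour integral -/

theorem exp_sub_one_mem_cutPlane {ζ : ℂ} (h : |ζ.im| < Real.pi) : Complex.exp ζ - 1 ∈ cutPlane := by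
  rw [mem_cutPlane_iff, add_sub_cancel, Complex.mem_slitPlane_iff_arg]
  rw [abs_lt] at h
  refine ⟨?_, Complex.exp_ne_zero _⟩
  rw [← Complex.log_im, Complex.log_exp h.1 h.2.le]
  exact h.2.ne

theorem fCut_exp_sub_one (r : ℝ) {ζ : ℂ} (h : |ζ.im| < Real.pi) (h0 : ζ ≠ 0) :
    fCut r (Complex.exp ζ - 1) = Complex.log (1 - r + r * Complex.exp ζ) / ζ := by
  rw [abs_lt] at h
  have h1 : Complex.exp ζ - 1 ≠ 0 := by
    intro h2
    have := Complex.log_exp h.1 h.2.le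
    rw [sub_eq_zero.1 h2, Complex.log_one] at this
    exact h0 this.symm
  rw [fCut, if_neg h1, add_sub_cancel, Complex.log_exp h.1 h.2.le]
  congr 2; ring

theorem norm_affine_exp_le {r : ℝ} (h0 : 0 < r) (h1 : r < 1) (ζ : ℂ) :
    ‖(1 - r + r * Complex.exp ζ : ℂ)‖ ≤ 1 - r + r * Real.exp ζ.re := by
  refine (norm_add_le _ _).trans (le_of_eq ?_)
  rw [norm_mul, Complex.norm_exp, Complex.norm_of_nonneg h0.le]
  rw [← Complex.ofReal_one, ← Complex.ofReal_sub, Complex.norm_of_nonneg (by linarith)]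

theorem le_norm_affine_exp {r : ℝ} (h0 : 0 < r) (h1 : r < 1) (ζ : ℂ) :
    |1 - r - r * Real.exp ζ.re| ≤ ‖(1 - r + r * Complex.exp ζ : ℂ)‖ := by
  have := abs_norm_sub_norm_le (1 - r : ℂ) (-(r * Complex.exp ζ))
  rw [norm_neg, norm_mul, Complex.norm_exp, Complex.norm_of_nonneg h0.le, sub_neg_eq_add,
    ← Complex.ofReal_one, ← Complex.ofReal_sub, Complex.norm_of_nonneg (by linarith)] at this
  simpa using this

/-- The Cauchy kernel for `fCut r` at `z`, pulled back by `w = exp ζ - 1`, without its pole. -/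
noncomputable def stripKernel (r : ℝ) (z ζ : ℂ) : ℂ :=
  Complex.exp ζ * dslope (fCut r) z (Complex.exp ζ - 1)

theorem stripKernel_eq {r : ℝ} {z ζ : ℂ} (h : Complex.exp ζ ≠ 1 + z) :
    stripKernel r z ζ =
      Complex.exp ζ / (Complex.exp ζ - (1 + z)) * (fCut r (Complex.exp ζ - 1) - fCut r z) := by
  have h' : Complex.exp ζ - 1 ≠ z := fun h2 => h (by linear_combination h2)
  rw [stripKernel, dslope_of_ne _ h', slope_def_field, sub_sub]
  ring

theorem differentiableOn_stripKernel {r : ℝ} (h0 : 0 < r) (h1 : r < 1) {z : ℂ}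
    (hz : z ∈ cutPlane) : DifferentiableOn ℂ (stripKernel r z) {ζ | |ζ.im| < Real.pi} := by
  have h := (Complex.differentiableOn_dslope (isOpen_cutPlane.mem_nhds hz)).2
    (differentiableOn_fCut h0 h1)
  refine (Complex.differentiable_exp.differentiableOn).mul (h.comp ?_ ?_)
  · exact (Complex.differentiable_exp.sub_const 1).differentiableOn
  · intro ζ hζ; exact exp_sub_one_mem_cutPlane hζ

/-- Cauchy's theorem without a residue: the kernel is analytic even at the preimage of z. -/
theorem stripKernel_contour {r : ℝ} (h0 : 0 < r) (h1 : r < 1) {z : ℂ} (hz : z ∈ cutPlane)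
    {R y : ℝ} (hy0 : 0 < y) (hy : y < Real.pi) :
    (∫ x in -R..R, stripKernel r z (x - y * Complex.I)) -
        (∫ x in -R..R, stripKernel r z (x + y * Complex.I)) +
      Complex.I * (∫ u in -y..y, stripKernel r z (R + u * Complex.I)) -
      Complex.I * (∫ u in -y..y, stripKernel r z (-R + u * Complex.I)) = 0 := by
  have := Complex.integral_boundary_rect_eq_zero_of_differentiableOn (stripKernel r z)
    ⟨-R, -y⟩ ⟨R, y⟩ ((differentiableOn_stripKernel h0 h1 hz).mono ?_)
  · simpa [sub_eq_add_neg] using this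
  · intro ζ hζ
    rw [Complex.mem_reProdIm] at hζ
    have := hζ.2
    rw [uIcc_of_le (by simp; linarith)] at this
    simp only [mem_ofPred_eq, abs_lt]
    exact ⟨by linarith [this.1], by linarith [this.2]⟩

theorem continuous_stripKernel_line {r : ℝ} (h0 : 0 < r) (h1 : r < 1) {z : ℂ} (hz : z ∈ cutPlane)
    {y : ℝ} (hy : |y| < Real.pi) : Continuous fun x : ℝ => stripKernel r z (x + y * Complex.I) := by
  refine (differentiableOn_stripKernel h0 h1 hz).continuousOn.comp_continuous (by fun_prop) ?_
  intro x
  simpa using hy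

theorem continuousOn_stripKernel_vertical {r : ℝ} (h0 : 0 < r) (h1 : r < 1) {z : ℂ}
    (hz : z ∈ cutPlane) (x : ℝ) :
    ContinuousOn (fun u : ℝ => stripKernel r z (x + u * Complex.I)) (Ioo (-Real.pi) Real.pi) := by
  refine (differentiableOn_stripKernel h0 h1 hz).continuousOn.comp (by fun_prop) ?_
  intro u hu
  simpa [abs_lt] using hu

/-- The boundary value of `fCut r` at `-(1 + exp x)`, from the upper half-plane. -/
noncomputable def boundaryValue (r x : ℝ) : ℂ :=
  Complex.log ((1 - r - r * Real.exp x : ℝ) : ℂ) / (x + Real.pi * Complex.I)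

/-! ### Limits and domination at the edges of the strip -/

theorem exp_add_pi_mul_I (x : ℝ) :
    Complex.exp (x + Real.pi * Complex.I) = -(Real.exp x : ℂ) := by
  rw [Complex.exp_add, Complex.exp_pi_mul_I]; simp

theorem exp_sub_pi_mul_I (x : ℝ) :
    Complex.exp (x - Real.pi * Complex.I) = -(Real.exp x : ℂ) := by
  rw [Complex.exp_sub, Complex.exp_pi_mul_I]; simp [div_neg]

/-- The principal branch takes the value with argument +π on the negative axis, so it is continuous
there from above. -/
theorem tendsto_clog_nhdsWithin_im_nonneg {q : ℝ} (hq : q ≠ 0) :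
    Tendsto Complex.log (𝓝[{z : ℂ | 0 ≤ z.im}] (q : ℂ)) (𝓝 (Complex.log q)) := by
  rcases hq.lt_or_gt with h | h
  · exact Complex.continuousWithinAt_log_of_re_neg_of_im_zero (by simpa) (by simp)
  · exact (continuousAt_clog (Complex.ofReal_mem_slitPlane.2 h)).continuousWithinAt

theorem ne_zero_of_im_mem {x y : ℝ} (hy : 0 < y) : (x + y * Complex.I : ℂ) ≠ 0 := by
  intro h
  have := congrArg Complex.im h
  simp at this
  exact hy.ne' this

theorem tendsto_fCut_upper {r : ℝ} (h0 : 0 < r) {x : ℝ} (hx : 1 - r - r * Real.exp x ≠ 0) :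
    Tendsto (fun y : ℝ => fCut r (Complex.exp (x + y * Complex.I) - 1)) (𝓝[<] Real.pi)
      (𝓝 (boundaryValue r x)) := by
  have hev : ∀ᶠ y : ℝ in 𝓝[<] Real.pi, y ∈ Ioo 0 Real.pi :=
    Ioo_mem_nhdsLT Real.pi_pos
  -- The argument of the logarithm approaches the real axis from above, since sin y > 0 on (0, π).
  have hp : Tendsto (fun y : ℝ => (1 - r + r * Complex.exp (x + y * Complex.I) : ℂ)) (𝓝[<] Real.pi)
      (𝓝[{z : ℂ | 0 ≤ z.im}] ((1 - r - r * Real.exp x : ℝ) : ℂ)) := by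
    refine tendsto_nhdsWithin_iff.2 ⟨?_, ?_⟩
    · have hc : Continuous fun y : ℝ => (1 - r + r * Complex.exp (x + y * Complex.I) : ℂ) := by
        fun_prop
      have := hc.tendsto Real.pi
      rw [exp_add_pi_mul_I] at this
      refine (this.mono_left nhdsWithin_le_nhds).trans_eq ?_
      congr 1; push_cast; ring
    · filter_upwards [hev] with y hy
      have hs := Real.sin_pos_of_pos_of_lt_pi hy.1 hy.2
      have he := Real.exp_pos x
      simp only [Complex.add_im, Complex.sub_im, Complex.one_im, Complex.ofReal_im,
        Complex.im_ofReal_mul, Complex.exp_im]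
      simp
      positivity
  have hd : Tendsto (fun y : ℝ => (x + y * Complex.I : ℂ)) (𝓝[<] Real.pi)
      (𝓝 (x + Real.pi * Complex.I)) :=
    ((by fun_prop : Continuous fun y : ℝ => (x + y * Complex.I : ℂ)).tendsto Real.pi).mono_left
      nhdsWithin_le_nhds
  refine (((tendsto_clog_nhdsWithin_im_nonneg hx).comp hp).div hd
    (ne_zero_of_im_mem Real.pi_pos)).congr' ?_
  filter_upwards [hev] with y hy
  rw [fCut_exp_sub_one r (by simpa [abs_of_pos hy.1] using hy.2) (ne_zero_of_im_mem hy.1)]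
  rfl

theorem fCut_exp_sub_mul_I {r : ℝ} (h0 : 0 < r) (h1 : r < 1) {x y : ℝ} (hy : |y| < Real.pi) :
    fCut r (Complex.exp (x - y * Complex.I) - 1) =
      starRingEnd ℂ (fCut r (Complex.exp (x + y * Complex.I) - 1)) := by
  rw [← fCut_conj h0 h1 (exp_sub_one_mem_cutPlane (by simpa using hy))]
  simp [← Complex.exp_conj, sub_eq_add_neg]

theorem tendsto_fCut_lower {r : ℝ} (h0 : 0 < r) (h1 : r < 1) {x : ℝ}
    (hx : 1 - r - r * Real.exp x ≠ 0) :
    Tendsto (fun y : ℝ => fCut r (Complex.exp (x - y * Complex.I) - 1)) (𝓝[<] Real.pi)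
      (𝓝 (starRingEnd ℂ (boundaryValue r x))) := by
  refine ((Complex.continuous_conj.tendsto _).comp (tendsto_fCut_upper h0 hx)).congr' ?_
  filter_upwards [Ioo_mem_nhdsLT Real.pi_pos] with y hy
  rw [fCut_exp_sub_mul_I h0 h1 (by rw [abs_of_pos hy.1]; exact hy.2)]
  rfl

theorem norm_clog_le (p : ℂ) : ‖Complex.log p‖ ≤ |Real.log ‖p‖| + Real.pi := by
  refine (Complex.norm_le_abs_re_add_abs_im _).trans ?_
  rw [Complex.log_re, Complex.log_im]
  gcongr
  exact Complex.abs_arg_le_pi p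

theorem abs_log_le_of_mem_Icc {a b c : ℝ} (ha : 0 < a) (hab : a ≤ b) (hbc : b ≤ c) :
    |Real.log b| ≤ |Real.log a| + |Real.log c| := by
  have h1 := Real.log_le_log ha hab
  have h2 := Real.log_le_log (ha.trans_le hab) hbc
  rw [abs_le]
  constructor
  · linarith [neg_abs_le (Real.log a), abs_nonneg (Real.log c)]
  · linarith [le_abs_self (Real.log c), abs_nonneg (Real.log a)]

/-- A bound for `Log (1 - r + r exp ζ)` that only depends on the real part of `ζ`. -/
noncomputable def logBound (r x : ℝ) : ℝ :=
  |Real.log (1 - r - r * Real.exp x)| + |Real.log (1 - r + r * Real.exp x)| + Real.pi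

/-- Both triangle inequalities confine the modulus to an interval depending only on Re ζ, which
gives a majorant uniform in the height of the contour. -/
theorem norm_log_affine_exp_le {r : ℝ} (h0 : 0 < r) (h1 : r < 1) {ζ : ℂ}
    (h : 1 - r - r * Real.exp ζ.re ≠ 0) :
    ‖Complex.log (1 - r + r * Complex.exp ζ)‖ ≤ logBound r ζ.re := by
  refine (norm_clog_le _).trans ?_
  unfold logBound
  gcongr
  rw [← Real.log_abs (1 - r - r * Real.exp ζ.re)]
  exact abs_log_le_of_mem_Icc (abs_pos.2 h) (le_norm_affine_exp h0 h1 ζ) (norm_affine_exp_le h0 h1 ζ)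

theorem intervalIntegrable_log_one_sub_mul_exp (r a b : ℝ) :
    IntervalIntegrable (fun x => Real.log (1 - r - r * Real.exp x)) volume a b := by
  have h : MeromorphicOn (fun x : ℝ => 1 - r - r * Real.exp x) (uIcc a b) := by
    intro x _
    exact AnalyticAt.meromorphicAt (by fun_prop)
  simpa using h.intervalIntegrable_log_norm

theorem intervalIntegrable_logBound {r : ℝ} (h0 : 0 < r) (h1 : r < 1) (a b : ℝ) :
    IntervalIntegrable (logBound r) volume a b := by
  have hc : Continuous fun x : ℝ => |Real.log (1 - r + r * Real.exp x)| + Real.pi := by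
    refine (Continuous.abs (Continuous.log (by fun_prop) fun x => ?_)).add continuous_const
    have := Real.exp_pos x
    have : 0 < 1 - r + r * Real.exp x := by nlinarith
    exact this.ne'
  refine ((intervalIntegrable_log_one_sub_mul_exp r a b).abs.add
    (hc.intervalIntegrable a b)).congr ?_
  intro x _
  simp [logBound, add_assoc]

theorem ae_affine_exp_ne_zero {r : ℝ} (h0 : 0 < r) : ∀ᵐ x : ℝ, 1 - r - r * Real.exp x ≠ 0 := by
  refine (Set.Subsingleton.measure_zero (s := {x : ℝ | ¬ (1 - r - r * Real.exp x ≠ 0)}) ?_ volume)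
  intro x hx y hy
  simp only [ne_eq, not_not, mem_ofPred_eq] at hx hy
  refine Real.exp_injective (mul_left_cancel₀ h0.ne' ?_)
  linarith

/-- In the open strip the only preimage of 1 + z is Log(1 + z); on the edges exp ζ is a negative
real, which 1 + z is not. -/
theorem exp_ne_of_im_large {z ζ : ℂ} (hz : z ∈ cutPlane) (h : |(Complex.log (1 + z)).im| < |ζ.im|)
    (h' : |ζ.im| ≤ Real.pi) : Complex.exp ζ ≠ 1 + z := by
  intro he
  rcases h'.lt_or_eq with h2 | h2
  · rw [← he, Complex.log_exp (abs_lt.1 h2).1 (abs_lt.1 h2).2.le] at h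
    exact lt_irrefl _ h
  · have hs := mem_cutPlane_iff.1 hz
    rw [← he, Complex.mem_slitPlane_iff, Complex.exp_re, Complex.exp_im, ← Real.cos_abs, h2] at hs
    have h3 : Real.sin ζ.im = 0 := by
      rcases abs_eq Real.pi_pos.le |>.1 h2 with h | h <;> simp [h]
    have := Real.exp_pos ζ.re
    rw [h3] at hs
    simp at hs
    linarith

theorem abs_log_one_add_im_lt_pi {z : ℂ} (hz : z ∈ cutPlane) :
    |(Complex.log (1 + z)).im| < Real.pi := by
  rw [Complex.log_im]
  exact lt_of_le_of_ne (Complex.abs_arg_le_pi _) fun h =>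
    (Complex.mem_slitPlane_iff_arg.1 (mem_cutPlane_iff.1 hz)).1 (by
      rcases abs_eq Real.pi_pos.le |>.1 h with h | h
      · exact h
      · exact absurd h (Complex.neg_pi_lt_arg _).ne')

theorem exists_bound_kernel {z : ℂ} (hz : z ∈ cutPlane) (R : ℝ) {y₁ : ℝ}
    (hy₁ : |(Complex.log (1 + z)).im| < y₁) :
    ∃ C : ℝ, ∀ ζ : ℂ, |ζ.re| ≤ R → y₁ ≤ |ζ.im| → |ζ.im| ≤ Real.pi →
      ‖Complex.exp ζ / (Complex.exp ζ - (1 + z))‖ ≤ C := by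
  have hcl : IsClosed {ζ : ℂ | y₁ ≤ |ζ.im|} :=
    isClosed_le continuous_const (Complex.continuous_im.abs)
  have hK : IsCompact ((Icc (-R) R ×ℂ Icc (-Real.pi) Real.pi) ∩ {ζ : ℂ | y₁ ≤ |ζ.im|}) :=
    (isCompact_Icc.reProdIm isCompact_Icc).inter_right hcl
  have hcont : ContinuousOn (fun ζ : ℂ => Complex.exp ζ / (Complex.exp ζ - (1 + z)))
      ((Icc (-R) R ×ℂ Icc (-Real.pi) Real.pi) ∩ {ζ : ℂ | y₁ ≤ |ζ.im|}) := by
    refine ContinuousOn.div (by fun_prop) (by fun_prop) fun ζ hζ => sub_ne_zero.2 ?_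
    exact exp_ne_of_im_large hz (hy₁.trans_le hζ.2) (abs_le.2 hζ.1.2)
  obtain ⟨C, hC⟩ := hK.exists_bound_of_continuousOn hcont
  exact ⟨C, fun ζ h1 h2 h3 => hC ζ ⟨⟨abs_le.1 h1, abs_le.1 h3⟩, h2⟩⟩

theorem norm_stripKernel_le {r : ℝ} (h0 : 0 < r) (h1 : r < 1) {z ζ : ℂ} {C : ℝ}
    (hC : ‖Complex.exp ζ / (Complex.exp ζ - (1 + z))‖ ≤ C) (hne : Complex.exp ζ ≠ 1 + z)
    (hx : 1 - r - r * Real.exp ζ.re ≠ 0) (hy : 1 ≤ |ζ.im|) (hy' : |ζ.im| < Real.pi) :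
    ‖stripKernel r z ζ‖ ≤ C * (logBound r ζ.re + ‖fCut r z‖) := by
  have hζ : 1 ≤ ‖ζ‖ := hy.trans (Complex.abs_im_le_norm ζ)
  rw [stripKernel_eq hne, norm_mul]
  have h2 : ‖fCut r (Complex.exp ζ - 1)‖ ≤ logBound r ζ.re := by
    rw [fCut_exp_sub_one r hy' (norm_pos_iff.1 (by linarith)), norm_div]
    exact (div_le_self (norm_nonneg _) hζ).trans (norm_log_affine_exp_le h0 h1 hx)
  exact mul_le_mul hC ((norm_sub_le _ _).trans (by gcongr)) (norm_nonneg _)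
    ((norm_nonneg _).trans hC)

/-- On both edges exp ζ = -exp x, so the kernel factors agree, the terms in f_r(z) cancel, and only
the difference of conjugate boundary values remains. The interchange of limit and integral is
dominated convergence with `logBound`. -/
theorem tendsto_stripKernel_horizontal {r : ℝ} (h0 : 0 < r) (h1 : r < 1) {z : ℂ}
    (hz : z ∈ cutPlane) {R : ℝ} (hR : 0 < R) :
    Tendsto (fun y : ℝ => (∫ x in -R..R, stripKernel r z (x - y * Complex.I)) -
        ∫ x in -R..R, stripKernel r z (x + y * Complex.I)) (𝓝[<] Real.pi)
      (𝓝 (-2 * Complex.I * ∫ x in -R..R,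
        (Real.exp x / (Real.exp x + 1 + z) * (boundaryValue r x).im : ℂ))) := by
  -- Heights beyond y₁ stay away from Log(1 + z), which bounds the kernel, and exceed 1, so that
  -- division by ζ only decreases the logarithm.
  obtain ⟨y₁, hy₁, hy₁'⟩ := exists_between (max_lt (abs_log_one_add_im_lt_pi hz)
    (by linarith [Real.pi_gt_three] : 1 < Real.pi))
  obtain ⟨hy₂, hy₃⟩ := max_lt_iff.1 hy₁
  have hev : ∀ᶠ y : ℝ in 𝓝[<] Real.pi, y ∈ Ioo y₁ Real.pi := Ioo_mem_nhdsLT hy₁'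
  obtain ⟨C, hC⟩ := exists_bound_kernel hz R hy₂
  have hcont : ∀ y ∈ Ioo y₁ Real.pi,
      (Continuous fun x : ℝ => stripKernel r z (x - y * Complex.I)) ∧
      Continuous fun x : ℝ => stripKernel r z (x + y * Complex.I) := by
    intro y hy
    have hy0 : 0 < y := by linarith [hy.1]
    refine ⟨?_, continuous_stripKernel_line h0 h1 hz (by rw [abs_of_pos hy0]; exact hy.2)⟩
    have := continuous_stripKernel_line h0 h1 hz (y := -y) (by
      rw [abs_neg, abs_of_pos hy0]; exact hy.2)
    simpa [sub_eq_add_neg] using this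
  rw [← intervalIntegral.integral_const_mul]
  refine Tendsto.congr' (f₁ := fun y : ℝ => ∫ x in -R..R,
      (stripKernel r z (x - y * Complex.I) - stripKernel r z (x + y * Complex.I))) ?_ ?_
  · filter_upwards [hev] with y hy
    exact intervalIntegral.integral_sub ((hcont y hy).1.intervalIntegrable _ _)
      ((hcont y hy).2.intervalIntegrable _ _)
  refine intervalIntegral.tendsto_integral_filter_of_dominated_convergence
    (fun x => 2 * (C * (logBound r x + ‖fCut r z‖))) ?_ ?_ ?_ ?_
  · filter_upwards [hev] with y hy
    exact ((hcont y hy).1.sub (hcont y hy).2).aestronglyMeasurable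
  · filter_upwards [hev] with y hy
    filter_upwards [ae_affine_exp_ne_zero h0] with x hx hxR
    have hy0 : 0 < y := by linarith [hy.1]
    rw [uIoc_of_le (by linarith)] at hxR
    have hxR' : |x| ≤ R := abs_le.2 ⟨hxR.1.le, hxR.2⟩
    have hb : ∀ ζ : ℂ, ζ.re = x → |ζ.im| = y →
        ‖stripKernel r z ζ‖ ≤ C * (logBound r x + ‖fCut r z‖) := by
      intro ζ hre him
      rw [← hre] at hx hxR' ⊢
      refine norm_stripKernel_le h0 h1 (hC ζ hxR' ?_ ?_) (exp_ne_of_im_large hz ?_ ?_) hx ?_ ?_ <;>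
        rw [him] <;> linarith [hy.1, hy.2]
    have := (norm_sub_le _ _).trans (add_le_add
      (hb (x - y * Complex.I) (by simp) (by simp [abs_of_pos hy0]))
      (hb (x + y * Complex.I) (by simp) (by simp [abs_of_pos hy0])))
    linarith
  · exact (((intervalIntegrable_logBound h0 h1 _ _).add intervalIntegrable_const).const_mul C
      ).const_mul 2
  · filter_upwards [ae_affine_exp_ne_zero h0] with x hx _
    have hker : ∀ s : ℂ, Complex.exp (x + Real.pi * s) = -(Real.exp x : ℂ) →
        Tendsto (fun y : ℝ => Complex.exp (x + y * s) / (Complex.exp (x + y * s) - (1 + z)))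
          (𝓝[<] Real.pi) (𝓝 (Real.exp x / (Real.exp x + 1 + z))) := by
      intro s hs
      have hne : -(Real.exp x : ℂ) - (1 + z) ≠ 0 := by
        rw [sub_ne_zero, ← exp_add_pi_mul_I]
        refine exp_ne_of_im_large hz ?_ ?_ <;> simp [abs_of_pos Real.pi_pos]
        simpa using abs_log_one_add_im_lt_pi hz
      have hc : Continuous fun y : ℝ => Complex.exp (x + y * s) := by fun_prop
      have h2 := (hc.tendsto Real.pi)
      rw [hs] at h2
      refine ((h2.div (h2.sub_const (1 + z)) hne).mono_left nhdsWithin_le_nhds).trans_eq ?_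
      congr 1
      rw [show -(Real.exp x : ℂ) - (1 + z) = -(Real.exp x + 1 + z) by ring, neg_div_neg_eq]
    have hlow := (hker (-Complex.I) (by rw [mul_neg, ← sub_eq_add_neg, exp_sub_pi_mul_I])).mul
      ((tendsto_fCut_lower h0 h1 hx).sub_const (fCut r z))
    have hup := (hker Complex.I (exp_add_pi_mul_I x)).mul
      ((tendsto_fCut_upper h0 hx).sub_const (fCut r z))
    have hlim := hlow.sub hup
    have hval : (Real.exp x / (Real.exp x + 1 + z) *
          (starRingEnd ℂ (boundaryValue r x) - fCut r z) -
        Real.exp x / (Real.exp x + 1 + z) * (boundaryValue r x - fCut r z) : ℂ) =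
        -2 * Complex.I * (Real.exp x / (Real.exp x + 1 + z) * (boundaryValue r x).im) := by
      rw [← mul_sub, sub_sub_sub_cancel_right, ← neg_sub, Complex.sub_conj]
      push_cast; ring
    rw [hval] at hlim
    refine hlim.congr' ?_
    filter_upwards [hev] with y hy
    have hy0 : 0 < y := by linarith [hy.1]
    have hne : ∀ ζ : ℂ, |ζ.im| = y → Complex.exp ζ ≠ 1 + z := fun ζ him =>
      exp_ne_of_im_large hz (by rw [him]; linarith [hy.1]) (by rw [him]; exact hy.2.le)
    rw [stripKernel_eq (hne _ (by simp [abs_of_pos hy0])),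
      stripKernel_eq (hne _ (by simp [abs_of_pos hy0]))]
    simp only [mul_neg, ← sub_eq_add_neg]

/-! ### The vertical sides and the limiting Cauchy formula -/

theorem abs_log_norm_affine_exp_sub_re_le {r : ℝ} (h0 : 0 < r) (h1 : r < 1) {ζ : ℂ}
    (hζ : 0 ≤ ζ.re) (hζ' : 2 / r ≤ Real.exp ζ.re) :
    |Real.log ‖(1 - r + r * Complex.exp ζ : ℂ)‖ - ζ.re| ≤ |Real.log (r / 2)| := by
  have he := Real.exp_pos ζ.re
  have hup : ‖(1 - r + r * Complex.exp ζ : ℂ)‖ ≤ Real.exp ζ.re := by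
    refine (norm_affine_exp_le h0 h1 ζ).trans ?_
    nlinarith [Real.one_le_exp hζ]
  have hlow : r / 2 * Real.exp ζ.re ≤ ‖(1 - r + r * Complex.exp ζ : ℂ)‖ := by
    refine le_trans ?_ (le_norm_affine_exp h0 h1 ζ)
    rw [div_le_iff₀ h0] at hζ'
    refine le_trans ?_ (neg_le_abs _)
    nlinarith
  have hp : 0 < r / 2 * Real.exp ζ.re := by positivity
  have hl := Real.log_le_log hp hlow
  have hu := Real.log_le_log (hp.trans_le hlow) hup
  rw [Real.log_mul (by positivity) he.ne', Real.log_exp] at hl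
  rw [Real.log_exp] at hu
  rw [abs_le]
  constructor
  · linarith [neg_abs_le (Real.log (r / 2))]
  · linarith [abs_nonneg (Real.log (r / 2))]

theorem norm_ge_of_re_ge {ζ : ℂ} {x : ℝ} (h : x ≤ ζ.re) : x ≤ ‖ζ‖ :=
  h.trans ((le_abs_self _).trans (Complex.abs_re_le_norm ζ))

/-- The logarithm is ζ + O(1) as Re ζ → ∞ in the strip, so its quotient by ζ tends to 1. The filter
makes the limit uniform in Im ζ. -/
theorem tendsto_fCut_right {r : ℝ} (h0 : 0 < r) (h1 : r < 1) :
    Tendsto (fun ζ : ℂ => fCut r (Complex.exp ζ - 1))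
      (comap Complex.re atTop ⊓ 𝓟 {ζ : ℂ | |ζ.im| < Real.pi}) (𝓝 1) := by
  have hre : Tendsto Complex.re (comap Complex.re atTop ⊓ 𝓟 {ζ : ℂ | |ζ.im| < Real.pi}) atTop :=
    tendsto_comap.mono_left inf_le_left
  rw [tendsto_iff_norm_sub_tendsto_zero]
  have hb : Tendsto (fun ζ : ℂ => (|Real.log (r / 2)| + 2 * Real.pi) / ζ.re)
      (comap Complex.re atTop ⊓ 𝓟 {ζ : ℂ | |ζ.im| < Real.pi}) (𝓝 0) :=
    tendsto_const_nhds.div_atTop hre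
  refine squeeze_zero' (Eventually.of_forall fun _ => norm_nonneg _) ?_ hb
  filter_upwards [hre.eventually_ge_atTop 1,
    (Real.tendsto_exp_atTop.comp hre).eventually_ge_atTop (2 / r),
    mem_inf_of_right (mem_principal_self _)] with ζ h2 h3 him
  have him : |ζ.im| < Real.pi := him
  have hζ : ζ ≠ 0 := by
    rintro rfl; simp at h2; linarith
  rw [fCut_exp_sub_one r him hζ, div_sub_one hζ, norm_div]
  refine div_le_div₀ (by positivity) ?_ (by linarith) (norm_ge_of_re_ge le_rfl)
  refine (Complex.norm_le_abs_re_add_abs_im _).trans ?_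
  rw [Complex.sub_re, Complex.sub_im, Complex.log_re, Complex.log_im]
  refine add_le_add (abs_log_norm_affine_exp_sub_re_le h0 h1 (by linarith) h3) ?_
  refine (abs_sub _ _).trans ?_
  linarith [Complex.abs_arg_le_pi (1 - r + r * Complex.exp ζ : ℂ)]

theorem tendsto_stripKernel_right {r : ℝ} (h0 : 0 < r) (h1 : r < 1) (z : ℂ) :
    Tendsto (stripKernel r z) (comap Complex.re atTop ⊓ 𝓟 {ζ : ℂ | |ζ.im| < Real.pi})
      (𝓝 (1 - fCut r z)) := by
  have hre : Tendsto Complex.re (comap Complex.re atTop ⊓ 𝓟 {ζ : ℂ | |ζ.im| < Real.pi}) atTop :=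
    tendsto_comap.mono_left inf_le_left
  have he : Tendsto (fun ζ : ℂ => (1 + z) * Complex.exp (-ζ))
      (comap Complex.re atTop ⊓ 𝓟 {ζ : ℂ | |ζ.im| < Real.pi}) (𝓝 ((1 + z) * 0)) := by
    refine Tendsto.const_mul _ (tendsto_zero_iff_norm_tendsto_zero.2 ?_)
    simp only [Complex.norm_exp, Complex.neg_re]
    exact Real.tendsto_exp_neg_atTop_nhds_zero.comp hre
  rw [mul_zero] at he
  have hk := (he.const_sub 1).inv₀ (by simp)
  have := hk.mul ((tendsto_fCut_right h0 h1).sub_const (fCut r z))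
  rw [sub_zero, inv_one, one_mul] at this
  refine this.congr' ?_
  have hne : ∀ᶠ ζ in comap Complex.re atTop ⊓ 𝓟 {ζ : ℂ | |ζ.im| < Real.pi},
      (1 + z) * Complex.exp (-ζ) ≠ 1 := he.eventually_ne zero_ne_one
  filter_upwards [hne] with ζ hζ
  have hx := Complex.exp_ne_zero ζ
  rw [Complex.exp_neg] at hζ ⊢
  have h2 : Complex.exp ζ ≠ 1 + z := by
    intro h; rw [← h, mul_inv_cancel₀ hx] at hζ; exact hζ rfl
  rw [stripKernel_eq h2]
  congr 1
  have h3 : Complex.exp ζ - (1 + z) ≠ 0 := sub_ne_zero.2 h2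
  rw [← div_eq_mul_inv, one_sub_div hx, inv_div]

/-- As Re ζ → -∞ the factor exp ζ/(exp ζ - (1 + z)) vanishes, while f_r tends to 0 because the
logarithm tends to log(1 - r). -/
theorem tendsto_stripKernel_left {r : ℝ} (h1 : r < 1) {z : ℂ}
    (hz : z ∈ cutPlane) :
    Tendsto (stripKernel r z) (comap Complex.re atBot ⊓ 𝓟 {ζ : ℂ | |ζ.im| < Real.pi})
      (𝓝 0) := by
  have hre : Tendsto Complex.re (comap Complex.re atBot ⊓ 𝓟 {ζ : ℂ | |ζ.im| < Real.pi}) atBot :=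
    tendsto_comap.mono_left inf_le_left
  have he : Tendsto Complex.exp
      (comap Complex.re atBot ⊓ 𝓟 {ζ : ℂ | |ζ.im| < Real.pi}) (𝓝 0) := by
    refine tendsto_zero_iff_norm_tendsto_zero.2 ?_
    simp only [Complex.norm_exp]
    exact Real.tendsto_exp_atBot.comp hre
  have hz0 : 1 + z ≠ 0 := Complex.slitPlane_ne_zero (mem_cutPlane_iff.1 hz)
  have hinv : Tendsto (fun ζ : ℂ => ζ⁻¹)
      (comap Complex.re atBot ⊓ 𝓟 {ζ : ℂ | |ζ.im| < Real.pi}) (𝓝 0) := by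
    refine tendsto_inv₀_cobounded.comp (tendsto_norm_atTop_iff_cobounded.1 ?_)
    refine tendsto_atTop_mono (fun ζ => (neg_le_abs _).trans (Complex.abs_re_le_norm ζ)) ?_
    exact tendsto_neg_atBot_atTop.comp hre
  have hp := (he.const_mul (r : ℂ)).const_add (1 - r : ℂ)
  rw [mul_zero, add_zero] at hp
  have hlog := hp.clog (by
    rw [← Complex.ofReal_one, ← Complex.ofReal_sub, Complex.ofReal_mem_slitPlane]; linarith)
  have hk := he.div (he.sub_const (1 + z)) (by rw [zero_sub]; exact neg_ne_zero.2 hz0)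
  have := hk.mul ((hlog.mul hinv).sub_const (fCut r z))
  rw [zero_div, zero_mul] at this
  refine this.congr' ?_
  filter_upwards [he.eventually_ne hz0.symm, hre.eventually_lt_atBot 0,
    mem_inf_of_right (mem_principal_self _)] with ζ h2 h3 him
  rw [stripKernel_eq h2, fCut_exp_sub_one r him (by rintro rfl; simp at h3), div_eq_mul_inv]
  rfl

theorem norm_integral_sub_le_of_norm_sub_le {g : ℝ → ℂ} {c : ℂ} {ε y : ℝ} (hy : 0 ≤ y)
    (hg : IntervalIntegrable g volume (-y) y)
    (h : ∀ u ∈ Icc (-y) y, ‖g u - c‖ ≤ ε) :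
    ‖(∫ u in -y..y, g u) - 2 * y * c‖ ≤ 2 * y * ε := by
  have h2 : (∫ u in -y..y, g u) - 2 * y * c = ∫ u in -y..y, (g u - c) := by
    rw [intervalIntegral.integral_sub hg intervalIntegrable_const, intervalIntegral.integral_const,
      Complex.real_smul]
    push_cast; ring
  rw [h2]
  refine (intervalIntegral.norm_integral_le_of_norm_le_const (C := ε) fun u hu => h u ?_).trans ?_
  · rw [uIoc_of_le (by linarith)] at hu
    exact Ioc_subset_Icc_self hu
  · rw [abs_of_nonneg (by linarith)]
    exact le_of_eq (by ring)

theorem eventually_vertical {g : ℂ → ℂ} {c : ℂ} {l : Filter ℝ}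
    (h : Tendsto g (comap Complex.re l ⊓ 𝓟 {ζ : ℂ | |ζ.im| < Real.pi}) (𝓝 c))
    {ε : ℝ} (hε : 0 < ε) :
    ∀ᶠ R : ℝ in l, ∀ u : ℝ, |u| < Real.pi → ‖g (R + u * Complex.I) - c‖ ≤ ε := by
  have h2 := h.eventually (Metric.closedBall_mem_nhds c hε)
  rw [eventually_inf_principal, eventually_comap] at h2
  filter_upwards [h2] with R hR u hu
  simpa [dist_eq_norm] using hR (R + u * Complex.I) (by simp) (by simpa using hu)

/-- For fixed large R each vertical side is within 2yδ of its limiting value, uniformly in y. The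
total error 4πδ therefore survives y → π, and only then does R grow. -/
theorem tendsto_integral_boundaryValue {r : ℝ} (h0 : 0 < r) (h1 : r < 1) {z : ℂ}
    (hz : z ∈ cutPlane) :
    Tendsto (fun R : ℝ => ∫ x in -R..R,
        (Real.exp x / (Real.exp x + 1 + z) * (boundaryValue r x).im : ℂ)) atTop
      (𝓝 (Real.pi * (1 - fCut r z))) := by
  rw [Metric.tendsto_nhds]
  intro ε hε
  have hπ := Real.pi_pos
  obtain ⟨δ, hδ, hδε⟩ : ∃ δ : ℝ, 0 < δ ∧ 2 * Real.pi * δ < ε :=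
    ⟨ε / (4 * Real.pi), by positivity, by field_simp; norm_num⟩
  filter_upwards [eventually_vertical (tendsto_stripKernel_right h0 h1 z) hδ,
    tendsto_neg_atTop_atBot.eventually (eventually_vertical (tendsto_stripKernel_left h1 hz) hδ),
    eventually_gt_atTop 0] with R hr hl hR
  have hlim := ((tendsto_stripKernel_horizontal h0 h1 hz hR).add
    (((Complex.continuous_ofReal.tendsto Real.pi).mono_left
      (nhdsWithin_le_nhds (s := Iio Real.pi))).const_mul
        (2 * Complex.I * (1 - fCut r z)))).norm
  have hbound : ∀ᶠ y : ℝ in 𝓝[<] Real.pi,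
      ‖(∫ x in -R..R, stripKernel r z (x - y * Complex.I)) -
        (∫ x in -R..R, stripKernel r z (x + y * Complex.I)) +
          2 * Complex.I * (1 - fCut r z) * y‖ ≤ 4 * Real.pi * δ := by
    filter_upwards [Ioo_mem_nhdsLT hπ] with y hy
    have hsub : Icc (-y) y ⊆ Ioo (-Real.pi) Real.pi := fun u hu =>
      ⟨by linarith [hu.1, hy.2], by linarith [hu.2, hy.2]⟩
    have hint : ∀ x : ℝ,
        IntervalIntegrable (fun u : ℝ => stripKernel r z (x + u * Complex.I)) volume (-y) y := by
      intro x
      refine ((continuousOn_stripKernel_vertical h0 h1 hz x).mono ?_).intervalIntegrable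
      rwa [uIcc_of_le (by linarith [hy.1])]
    have hR1 := norm_integral_sub_le_of_norm_sub_le hy.1.le (hint R)
      fun u hu => hr u (abs_lt.2 (hsub hu))
    have hL1 := norm_integral_sub_le_of_norm_sub_le hy.1.le (hint (-R))
      fun u hu => hl u (abs_lt.2 (hsub hu))
    have hc := stripKernel_contour h0 h1 hz (R := R) hy.1 hy.2
    push_cast at hL1
    set VR := ∫ u in -y..y, stripKernel r z (R + u * Complex.I)
    set VL := ∫ u in -y..y, stripKernel r z (-R + u * Complex.I)
    have heq : (∫ x in -R..R, stripKernel r z (x - y * Complex.I)) -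
        (∫ x in -R..R, stripKernel r z (x + y * Complex.I)) +
          2 * Complex.I * (1 - fCut r z) * y =
        Complex.I * ((VL - 2 * y * 0) - (VR - 2 * y * (1 - fCut r z))) := by
      linear_combination hc
    rw [heq, norm_mul, Complex.norm_I, one_mul]
    refine (norm_sub_le _ _).trans ((add_le_add hL1 hR1).trans ?_)
    nlinarith [hy.2]
  have hfin := le_of_tendsto hlim hbound
  set J := ∫ x in -R..R, (Real.exp x / (Real.exp x + 1 + z) * (boundaryValue r x).im : ℂ)
  have heq : -2 * Complex.I * J + 2 * Complex.I * (1 - fCut r z) * Real.pi =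
      -2 * Complex.I * (J - Real.pi * (1 - fCut r z)) := by ring
  rw [heq] at hfin
  simp only [norm_mul, norm_neg, Complex.norm_ofNat, Complex.norm_I] at hfin
  rw [dist_eq_norm]
  linarith

/-! ### The density as boundary value, and its integrability -/

/-- At t = 1/r both sides are 0, since `EReal.toReal ⊤ = 0` and `Real.log 0 = 0`; hence the
non-strict case split. Beyond 1/r, `Real.log` ignores the sign of 1 - rt. -/
theorem toReal_sigma {r : ℝ} (h0 : 0 < r) (t : ℝ) (ht : 1 < t) :
    (sigma r t).toReal =
      (if t ≤ 1 / r then -Real.log (1 - r * t) else Real.log (t - 1) - Real.log (1 - r * t)) /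
        (t * (Real.log (t - 1) ^ 2 + Real.pi ^ 2)) := by
  unfold sigma
  rcases lt_trichotomy t (1 / r) with h | h | h
  · rw [if_pos h, if_pos h.le, EReal.toReal_coe]
  · rw [if_neg h.not_lt, if_pos h, if_pos h.le, EReal.toReal_top, h, mul_one_div_cancel h0.ne']
    simp
  · rw [if_neg h.not_gt, if_neg h.ne', if_neg h.not_ge, EReal.toReal_coe]
    have h1 : 1 < r * t := by rwa [div_lt_iff₀' h0] at h
    rw [Real.log_div (by linarith) (by linarith), ← Real.log_neg_eq_log (1 - r * t), neg_sub]

theorem sigma_nonneg {r : ℝ} (h0 : 0 < r) (h1 : r < 1) {t : ℝ} (ht : 1 < t) : 0 ≤ sigma r t := by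
  have hπ := Real.pi_pos
  have hd : 0 < t * (Real.log (t - 1) ^ 2 + Real.pi ^ 2) := by positivity
  unfold sigma
  split_ifs with h h'
  · rw [lt_div_iff₀' h0] at h
    refine EReal.coe_nonneg.2 (div_nonneg ?_ hd.le)
    have : 0 < r * t := by positivity
    exact neg_nonneg.2 (Real.log_nonpos (by linarith) (by linarith))
  · exact le_top
  · have h2 : 1 < r * t := by
      rw [← div_lt_iff₀' h0]; exact lt_of_le_of_ne (not_lt.1 h) (Ne.symm h')
    refine EReal.coe_nonneg.2 (div_nonneg (Real.log_nonneg ?_) hd.le)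
    rw [le_div_iff₀ (by linarith)]
    nlinarith

theorem sigma_pos {r : ℝ} (h0 : 0 < r) (h1 : r < 1) {t : ℝ} (ht : 1 < t) (ht' : t ≠ 1 / r) :
    0 < (sigma r t).toReal := by
  have hπ := Real.pi_pos
  have hd : 0 < t * (Real.log (t - 1) ^ 2 + Real.pi ^ 2) := by positivity
  unfold sigma
  rw [if_neg ht']
  split_ifs with h
  · rw [lt_div_iff₀' h0] at h
    refine div_pos ?_ hd
    have : 0 < r * t := by positivity
    exact neg_pos.2 (Real.log_neg (by linarith) (by linarith))
  · have h2 : 1 < r * t := by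
      rw [← div_lt_iff₀' h0]; exact lt_of_le_of_ne (not_lt.1 h) (Ne.symm ht')
    refine div_pos (Real.log_pos ?_) hd
    rw [lt_div_iff₀ (by linarith)]
    nlinarith

theorem toReal_sigma_nonneg {r : ℝ} (h0 : 0 < r) (h1 : r < 1) {t : ℝ} (ht : 1 < t) :
    0 ≤ (sigma r t).toReal := EReal.toReal_nonneg (sigma_nonneg h0 h1 ht)

theorem measurable_sigma (r : ℝ) : Measurable (sigma r) := by
  unfold sigma
  refine Measurable.ite measurableSet_Iio (by fun_prop) (Measurable.ite ?_ (by fun_prop)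
    (by fun_prop))
  exact measurableSet_singleton (1 / r)

/-- With t = 1 + exp x and q = 1 - rt, the imaginary part is (x arg q - π log|q|)/(x² + π²), where x
= log(t - 1). The argument 0 or π of q produces the two branches of σ_r. -/
theorem boundaryValue_im {r : ℝ} (h0 : 0 < r) (x : ℝ) :
    (boundaryValue r x).im =
      Real.pi * ((1 + Real.exp x) * (sigma r (1 + Real.exp x)).toReal) := by
  have he := Real.exp_pos x
  have hπ := Real.pi_pos
  rw [toReal_sigma h0 _ (by linarith), add_sub_cancel_left, Real.log_exp]
  have hq : 1 - r * (1 + Real.exp x) = 1 - r - r * Real.exp x := by ring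
  have hiff : 1 + Real.exp x ≤ 1 / r ↔ 0 ≤ 1 - r - r * Real.exp x := by
    rw [le_div_iff₀' h0]
    constructor <;> intro h <;> linarith
  simp only [hq, hiff]
  rw [boundaryValue, Complex.div_im]
  have hn : Complex.normSq (x + Real.pi * Complex.I) = x ^ 2 + Real.pi ^ 2 := by
    rw [Complex.normSq_add_mul_I]
  have hd : x ^ 2 + Real.pi ^ 2 ≠ 0 := by positivity
  have ht : 1 + Real.exp x ≠ 0 := by positivity
  rw [hn, Complex.log_re, Complex.log_im, Complex.norm_real, Real.norm_eq_abs, Real.log_abs]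
  simp only [Complex.add_re, Complex.add_im, Complex.ofReal_re, Complex.ofReal_im, Complex.mul_re,
    Complex.mul_im, Complex.I_re, Complex.I_im]
  split_ifs with h
  · rw [Complex.arg_ofReal_of_nonneg (by linarith)]
    field_simp; ring
  · rw [Complex.arg_ofReal_of_neg (by linarith)]
    field_simp; ring

theorem intervalIntegrable_boundaryValue_im {r : ℝ} (a b : ℝ) :
    IntervalIntegrable (fun x => (boundaryValue r x).im) volume a b := by
  have hπ := Real.pi_pos
  have hb : IntervalIntegrable
      (fun x => |Real.log (1 - r - r * Real.exp x)| + Real.pi) volume a b :=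
    (intervalIntegrable_log_one_sub_mul_exp r a b).abs.add intervalIntegrable_const
  refine hb.mono_fun ?_ (Eventually.of_forall fun x => ?_)
  · refine Measurable.aestronglyMeasurable ?_
    unfold boundaryValue
    fun_prop
  · beta_reduce
    have hden : 1 ≤ ‖(x + Real.pi * Complex.I : ℂ)‖ := by
      refine le_trans ?_ (Complex.abs_im_le_norm _)
      simp [abs_of_pos hπ]
      linarith [Real.pi_gt_three]
    have h1 := norm_clog_le ((1 - r - r * Real.exp x : ℝ) : ℂ)
    rw [Complex.norm_real, Real.norm_eq_abs, Real.log_abs] at h1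
    rw [Real.norm_eq_abs, Real.norm_eq_abs, abs_of_nonneg (by positivity :
      0 ≤ |Real.log (1 - r - r * Real.exp x)| + Real.pi)]
    refine (Complex.abs_im_le_norm _).trans (le_trans ?_ h1)
    rw [boundaryValue, norm_div]
    exact div_le_self (norm_nonneg _) hden

theorem image_one_add_exp : (fun x : ℝ => 1 + Real.exp x) '' univ = Ioi 1 := by
  ext t
  simp only [image_univ, mem_range, mem_Ioi]
  constructor
  · rintro ⟨x, rfl⟩; linarith [Real.exp_pos x]
  · intro ht
    exact ⟨Real.log (t - 1), by rw [Real.exp_log (by linarith)]; ring⟩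

theorem injOn_one_add_exp : InjOn (fun x : ℝ => 1 + Real.exp x) univ := fun _ _ _ _ h =>
  Real.exp_injective (add_left_cancel h)

theorem hasDerivWithinAt_one_add_exp (x : ℝ) :
    HasDerivWithinAt (fun x : ℝ => 1 + Real.exp x) (Real.exp x) univ x :=
  ((Real.hasDerivAt_exp x).const_add 1).hasDerivWithinAt

theorem integrableOn_Ioi_one_iff_comp_exp {E : Type*} [NormedAddCommGroup E] [NormedSpace ℝ E]
    (g : ℝ → E) :
    IntegrableOn g (Ioi 1) ↔ Integrable fun x : ℝ => Real.exp x • g (1 + Real.exp x) := by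
  have := integrableOn_image_iff_integrableOn_abs_deriv_smul MeasurableSet.univ
    (fun x _ => hasDerivWithinAt_one_add_exp x) injOn_one_add_exp g
  rw [image_one_add_exp] at this
  simpa using this

theorem integral_Ioi_one_eq_integral_comp_exp {E : Type*} [NormedAddCommGroup E] [NormedSpace ℝ E]
    (g : ℝ → E) :
    ∫ t in Ioi 1, g t = ∫ x : ℝ, Real.exp x • g (1 + Real.exp x) := by
  have := integral_image_eq_integral_abs_deriv_smul MeasurableSet.univ
    (fun x _ => hasDerivWithinAt_one_add_exp x) injOn_one_add_exp g
  rw [image_one_add_exp] at this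
  simpa using this

/-- The limiting formula at z = 0 bounds the integrals over [-R, R] of a non-negative function,
which forces integrability. -/
theorem integrableOn_sigma {r : ℝ} (h0 : 0 < r) (h1 : r < 1) :
    IntegrableOn (fun t => (sigma r t).toReal) (Ioi 1) := by
  rw [integrableOn_Ioi_one_iff_comp_exp]
  have heq : ∀ x, Real.exp x • (sigma r (1 + Real.exp x)).toReal =
      Real.exp x / (Real.exp x + 1) / Real.pi * (boundaryValue r x).im := by
    intro x
    have := Real.exp_pos x
    have := Real.pi_pos
    rw [boundaryValue_im h0, smul_eq_mul]
    field_simp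
    ring
  have hii : ∀ R : ℝ, IntervalIntegrable
      (fun x => Real.exp x • (sigma r (1 + Real.exp x)).toReal) volume (-R) R := by
    intro R
    simp_rw [heq]
    refine (intervalIntegrable_boundaryValue_im (-R) R).continuousOn_mul ?_
    refine Continuous.continuousOn (Continuous.div_const (Continuous.div (by fun_prop)
      (by fun_prop) fun x => ?_) _)
    have := Real.exp_pos x
    positivity
  have hlim := tendsto_integral_boundaryValue h0 h1 zero_mem_cutPlane
  have hnorm := hlim.norm
  refine integrable_of_intervalIntegral_norm_bounded (l := atTop) (a := fun R : ℝ => -R)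
    (b := fun R => R) ((‖(Real.pi * (1 - fCut r 0) : ℂ)‖ + 1) / Real.pi) ?_ tendsto_neg_atTop_atBot
    tendsto_id ?_
  · intro R
    exact (hii R).1
  · filter_upwards [hnorm.eventually_lt_const (lt_add_one _)] with R hR
    rw [le_div_iff₀ Real.pi_pos, mul_comm, ← intervalIntegral.integral_const_mul]
    refine le_trans ?_ hR.le
    have hc : (∫ x in -R..R, (Real.exp x / (Real.exp x + 1 + 0) * (boundaryValue r x).im : ℂ)) =
        ((∫ x in -R..R, Real.pi * ‖Real.exp x • (sigma r (1 + Real.exp x)).toReal‖ : ℝ) : ℂ) := by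
      rw [← intervalIntegral.integral_ofReal]
      congr 1 with x
      have hp := Real.exp_pos x
      rw [Real.norm_of_nonneg (smul_nonneg hp.le (toReal_sigma_nonneg h0 h1 (by linarith))), heq]
      have := Real.pi_pos
      rw [← mul_assoc, mul_div_cancel₀ _ this.ne']
      push_cast
      rw [add_zero]
    rw [hc, Complex.norm_real]
    exact le_abs_self _

/-! ### Integral representations on the cut plane -/

theorem integrableOn_ofReal_sigma {r : ℝ} (h0 : 0 < r) (h1 : r < 1) :
    IntegrableOn (fun t => ((sigma r t).toReal : ℂ)) (Ioi 1) :=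
  (integrableOn_sigma h0 h1).ofReal

/-- With s = 1/t the quotient is 1/(1 + sz), continuous for s in the compact interval [0, 1]. -/
theorem exists_bound_div_add {z : ℂ} (hz : z ∈ cutPlane) :
    ∃ C : ℝ, ∀ t : ℝ, 1 < t → ‖(t : ℂ) / (z + t)‖ ≤ C := by
  have hcont : ContinuousOn (fun s : ℝ => (1 + (s : ℂ) * z)⁻¹) (Icc 0 1) := by
    refine ContinuousOn.inv₀ (by fun_prop) fun s hs => ?_
    rcases hs.1.eq_or_lt with rfl | h
    · simp
    · exact Complex.slitPlane_ne_zero (one_add_mul_mem_slitPlane h hs.2 hz)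
  obtain ⟨C, hC⟩ := isCompact_Icc.exists_bound_of_continuousOn hcont
  refine ⟨C, fun t ht => ?_⟩
  have ht0 : (t : ℂ) ≠ 0 := by exact_mod_cast (by linarith : t ≠ 0)
  have := hC t⁻¹ ⟨by positivity, inv_le_one_of_one_le₀ ht.le⟩
  rwa [Complex.ofReal_inv, inv_mul_eq_div, one_add_div ht0, inv_div, add_comm (t : ℂ)] at this

theorem integrableOn_mul_sigma_div {r : ℝ} (h0 : 0 < r) (h1 : r < 1) {z : ℂ} (hz : z ∈ cutPlane) :
    IntegrableOn (fun t : ℝ => (t : ℂ) * ((sigma r t).toReal : ℂ) / (z + (t : ℂ))) (Ioi 1) := by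
  obtain ⟨C, hC⟩ := exists_bound_div_add hz
  have h := integrableOn_ofReal_sigma h0 h1
  refine (Integrable.bdd_mul (f := fun t : ℝ => (t : ℂ) / (z + t)) (c := C) h ?_ ?_).congr ?_
  · exact (by fun_prop : Measurable fun t : ℝ => (t : ℂ) / (z + t)).aestronglyMeasurable
  · exact (ae_restrict_mem measurableSet_Ioi).mono fun t ht => hC t ht
  · refine Eventually.of_forall fun t => ?_
    beta_reduce
    ring

theorem one_sub_fCut_eq {r : ℝ} (h0 : 0 < r) (h1 : r < 1) {z : ℂ} (hz : z ∈ cutPlane) :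
    1 - fCut r z = ∫ t in Ioi (1 : ℝ), (t : ℂ) * ((sigma r t).toReal : ℂ) / (z + (t : ℂ)) := by
  have hint := (integrableOn_Ioi_one_iff_comp_exp _).1 (integrableOn_mul_sigma_div h0 h1 hz)
  rw [integral_Ioi_one_eq_integral_comp_exp]
  have hlim := (intervalIntegral_tendsto_integral hint tendsto_neg_atTop_atBot
    tendsto_id).const_mul (Real.pi : ℂ)
  have hπ : (Real.pi : ℂ) ≠ 0 := by exact_mod_cast Real.pi_ne_zero
  refine mul_left_cancel₀ hπ (tendsto_nhds_unique (tendsto_integral_boundaryValue h0 h1 hz)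
    (hlim.congr fun R => ?_))
  rw [← intervalIntegral.integral_const_mul]
  congr 1 with x
  rw [boundaryValue_im h0, Complex.real_smul]
  push_cast
  rw [show z + (1 + Complex.exp x) = Complex.exp x + 1 + z by ring]
  ring

theorem fCut_zero (r : ℝ) : fCut r 0 = r := if_pos rfl

theorem integral_sigma {r : ℝ} (h0 : 0 < r) (h1 : r < 1) :
    ∫ t in Ioi (1 : ℝ), (sigma r t).toReal = 1 - r := by
  have h := one_sub_fCut_eq h0 h1 zero_mem_cutPlane
  have h2 : ∫ t in Ioi (1 : ℝ), (t : ℂ) * ((sigma r t).toReal : ℂ) / (0 + (t : ℂ)) =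
      ((∫ t in Ioi (1 : ℝ), (sigma r t).toReal : ℝ) : ℂ) := by
    rw [← integral_complex_ofReal]
    refine setIntegral_congr_fun measurableSet_Ioi fun t ht => ?_
    have ht0 : (t : ℂ) ≠ 0 := by
      have : (1 : ℝ) < t := ht
      exact_mod_cast (by linarith : t ≠ 0)
    simp only [zero_add]
    rw [mul_div_cancel_left₀ _ ht0]
  rw [h2, fCut_zero] at h
  exact_mod_cast h.symm

theorem add_ofReal_ne_zero {z : ℂ} (hz : z ∈ cutPlane) {t : ℝ} (ht : 1 < t) : z + t ≠ 0 := by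
  intro h
  refine hz ⟨-t, by simp; linarith, ?_⟩
  push_cast
  linear_combination -h

theorem div_add_mul_sigma_eq {r : ℝ} {z : ℂ} (hz : z ∈ cutPlane) {t : ℝ} (ht : 1 < t) :
    z / (z + (t : ℂ)) * ((sigma r t).toReal : ℂ) =
      ((sigma r t).toReal : ℂ) - (t : ℂ) * ((sigma r t).toReal : ℂ) / (z + (t : ℂ)) := by
  have := add_ofReal_ne_zero hz ht
  field_simp
  ring

theorem integrableOn_div_add_mul_sigma {r : ℝ} (h0 : 0 < r) (h1 : r < 1) {z : ℂ}
    (hz : z ∈ cutPlane) :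
    IntegrableOn (fun t : ℝ => z / (z + (t : ℂ)) * ((sigma r t).toReal : ℂ)) (Ioi 1) :=
  IntegrableOn.congr_fun ((integrableOn_ofReal_sigma h0 h1).sub (integrableOn_mul_sigma_div h0 h1 hz))
    (fun _ ht => (div_add_mul_sigma_eq hz ht).symm) measurableSet_Ioi

/-- Write z/(z + t) = 1 - t/(z + t) and use that σ_r has total mass 1 - r. -/
theorem fCut_eq {r : ℝ} (h0 : 0 < r) (h1 : r < 1) {z : ℂ} (hz : z ∈ cutPlane) :
    fCut r z = (r : ℂ) +
      ∫ t in Ioi (1 : ℝ), z / (z + (t : ℂ)) * ((sigma r t).toReal : ℂ) := by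
  rw [setIntegral_congr_fun measurableSet_Ioi fun t ht => div_add_mul_sigma_eq hz ht]
  rw [integral_sub (integrableOn_ofReal_sigma h0 h1) (integrableOn_mul_sigma_div h0 h1 hz),
    ← one_sub_fCut_eq h0 h1 hz, integral_complex_ofReal, integral_sigma h0 h1]
  push_cast; ring

/-! ### Monotonicity, concavity and limits on (-1, ∞) -/

theorem integrableOn_real_mul_sigma_div {r : ℝ} (h0 : 0 < r) (h1 : r < 1) {x : ℝ} (hx : -1 < x) :
    IntegrableOn (fun t : ℝ => t * (sigma r t).toReal / (x + t)) (Ioi 1) := by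
  have h := (integrableOn_mul_sigma_div h0 h1 (ofReal_mem_cutPlane hx)).re
  refine h.congr (Eventually.of_forall fun t => ?_)
  have : (t : ℂ) * ((sigma r t).toReal : ℂ) / ((x : ℂ) + (t : ℂ)) =
      ((t * (sigma r t).toReal / (x + t) : ℝ) : ℂ) := by push_cast; ring
  beta_reduce
  rw [this]
  exact Complex.ofReal_re _

theorem one_sub_fReal_eq {r : ℝ} (h0 : 0 < r) (h1 : r < 1) {x : ℝ} (hx : -1 < x) :
    1 - fReal r x = ∫ t in Ioi (1 : ℝ), t * (sigma r t).toReal / (x + t) := by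
  have h := one_sub_fCut_eq h0 h1 (ofReal_mem_cutPlane hx)
  rw [fCut_ofReal h0 h1 hx] at h
  have h2 : ∫ t in Ioi (1 : ℝ), (t : ℂ) * ((sigma r t).toReal : ℂ) / ((x : ℂ) + (t : ℂ)) =
      ((∫ t in Ioi (1 : ℝ), t * (sigma r t).toReal / (x + t) : ℝ) : ℂ) := by
    rw [← integral_complex_ofReal]
    congr 1 with t
    push_cast; ring
  rw [h2] at h
  exact_mod_cast h

/-- The exceptional point c serves for t = 1/r, where the real value of the density is 0. -/
theorem setIntegral_Ioi_pos_of_pos_of_ne {h : ℝ → ℝ} {a c : ℝ} (hint : IntegrableOn h (Ioi a))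
    (hpos : ∀ t, a < t → t ≠ c → 0 < h t) : 0 < ∫ t in Ioi a, h t := by
  have hne : ∀ᵐ t ∂volume.restrict (Ioi a), t ≠ c :=
    ae_restrict_of_ae (Measure.ae_ne volume c)
  have hae : ∀ᵐ t ∂volume.restrict (Ioi a), 0 < h t := by
    filter_upwards [hne, ae_restrict_mem measurableSet_Ioi] with t h1 h2
    exact hpos t h2 h1
  rw [integral_pos_iff_support_of_nonneg_ae (hae.mono fun t ht => ht.le) hint, pos_iff_ne_zero]
  intro h0
  have hz : ∀ᵐ t ∂volume.restrict (Ioi a), h t = 0 := by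
    rw [ae_iff]; exact h0
  have hF : ∀ᵐ t ∂volume.restrict (Ioi a), False := by
    filter_upwards [hae, hz] with t h1 h2
    exact h1.ne' h2
  rw [ae_iff] at hF
  simp at hF

theorem strictMonoOn_fReal {r : ℝ} (h0 : 0 < r) (h1 : r < 1) :
    StrictMonoOn (fReal r) (Ioi (-1)) := by
  intro x hx y hy hxy
  rw [mem_Ioi] at hx hy
  have hix := integrableOn_real_mul_sigma_div h0 h1 hx
  have hiy := integrableOn_real_mul_sigma_div h0 h1 hy
  have := setIntegral_Ioi_pos_of_pos_of_ne (c := 1 / r) (hix.sub hiy) fun t ht htr => by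
    have hs := sigma_pos h0 h1 ht htr
    exact sub_pos.2 (div_lt_div_of_pos_left (by positivity) (by linarith) (by linarith))
  rw [integral_sub' hix hiy, ← one_sub_fReal_eq h0 h1 hx, ← one_sub_fReal_eq h0 h1 hy] at this
  linarith

theorem inv_weighted_add_lt {a b u v : ℝ} (ha : 0 < a) (hb : 0 < b) (hab : a + b = 1) (hu : 0 < u)
    (hv : 0 < v) (huv : u ≠ v) : 1 / (a * u + b * v) < a / u + b / v := by
  have hs : 0 < (u - v) ^ 2 := by positivity [sub_ne_zero.2 huv]
  rw [div_add_div _ _ hu.ne' hv.ne', div_lt_div_iff₀ (by positivity) (by positivity), ← sub_pos]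
  have : (a * v + u * b) * (a * u + b * v) - 1 * (u * v) = a * b * (u - v) ^ 2 := by
    have hb' : b = 1 - a := by linarith
    subst hb'; ring
  rw [this]
  positivity

/-- The strict convexity of x ↦ 1/(x + t), integrated against t σ_r(t) dt, makes 1 - f_r strictly
convex. -/
theorem strictConcaveOn_fReal {r : ℝ} (h0 : 0 < r) (h1 : r < 1) :
    StrictConcaveOn ℝ (Ioi (-1)) (fReal r) := by
  refine ⟨convex_Ioi _, ?_⟩
  intro x hx y hy hxy a b ha hb hab
  have hz : a • x + b • y ∈ Ioi (-1 : ℝ) := convex_Ioi _ hx hy ha.le hb.le hab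
  rw [mem_Ioi] at hx hy hz
  simp only [smul_eq_mul] at hz ⊢
  have hix := integrableOn_real_mul_sigma_div h0 h1 hx
  have hiy := integrableOn_real_mul_sigma_div h0 h1 hy
  have hiz := integrableOn_real_mul_sigma_div h0 h1 hz
  have := setIntegral_Ioi_pos_of_pos_of_ne (c := 1 / r)
    (((hix.const_mul a).add (hiy.const_mul b)).sub hiz) fun t ht htr => by
    have hs := sigma_pos h0 h1 ht htr
    have hlt := inv_weighted_add_lt ha hb hab (by linarith : 0 < x + t) (by linarith : 0 < y + t)
      (by simpa using hxy)
    have he : a * (x + t) + b * (y + t) = a * x + b * y + t := by linear_combination t * hab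
    rw [he] at hlt
    have := mul_lt_mul_of_pos_left hlt (mul_pos (by linarith : 0 < t) hs)
    refine sub_pos.2 ?_
    simp only [Pi.add_apply]
    calc t * (sigma r t).toReal / (a * x + b * y + t) =
          t * (sigma r t).toReal * (1 / (a * x + b * y + t)) := by ring
      _ < t * (sigma r t).toReal * (a / (x + t) + b / (y + t)) := this
      _ = _ := by ring
  rw [integral_sub' ((hix.const_mul a).add (hiy.const_mul b)) hiz,
    integral_add' (hix.const_mul a) (hiy.const_mul b), integral_const_mul, integral_const_mul,
    ← one_sub_fReal_eq h0 h1 hx, ← one_sub_fReal_eq h0 h1 hy, ← one_sub_fReal_eq h0 h1 hz] at this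
  linarith

theorem tendsto_fReal_neg_one {r : ℝ} (h1 : r < 1) :
    Tendsto (fReal r) (𝓝[>] (-1)) (𝓝 0) := by
  have hnum : Tendsto (fun x : ℝ => Real.log (1 + r * x)) (𝓝[>] (-1))
      (𝓝 (Real.log (1 + r * (-1)))) := by
    refine Tendsto.mono_left ?_ nhdsWithin_le_nhds
    exact ((by fun_prop : Continuous fun x : ℝ => 1 + r * x).tendsto (-1)).log (by linarith)
  have hden : Tendsto (fun x : ℝ => Real.log (1 + x)) (𝓝[>] (-1)) atBot := by
    refine Real.tendsto_log_nhdsGT_zero.comp (tendsto_nhdsWithin_iff.2 ⟨?_, ?_⟩)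
    · refine Tendsto.mono_left ?_ nhdsWithin_le_nhds
      exact ((by fun_prop : Continuous fun x : ℝ => 1 + x).tendsto' (-1) 0 (by norm_num))
    · filter_upwards [self_mem_nhdsWithin] with x hx
      rw [mem_Ioi] at hx ⊢
      linarith
  refine (hnum.div_atBot hden).congr' ?_
  filter_upwards [Ioo_mem_nhdsGT (by norm_num : (-1 : ℝ) < 0)] with x hx
  rw [fReal, if_neg hx.2.ne]

/-- For x > 0, f_r(x) - 1 = log((1 + rx)/(1 + x))/log(1 + x), whose numerator tends to log r. -/
theorem tendsto_fReal_atTop {r : ℝ} (h0 : 0 < r) :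
    Tendsto (fReal r) atTop (𝓝 1) := by
  have hlog : Tendsto (fun x : ℝ => Real.log (1 + x)) atTop atTop :=
    Real.tendsto_log_atTop.comp (tendsto_atTop_add_const_left _ _ tendsto_id)
  have hq : Tendsto (fun x : ℝ => r + (1 - r) / (1 + x)) atTop (𝓝 (r + 0)) :=
    tendsto_const_nhds.add
      (tendsto_const_nhds.div_atTop (tendsto_atTop_add_const_left _ _ tendsto_id))
  rw [add_zero] at hq
  have h := ((hq.log h0.ne').div_atTop hlog).const_add 1
  rw [add_zero] at h
  refine h.congr' ?_
  filter_upwards [eventually_gt_atTop 0] with x hx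
  have hl : 0 < Real.log (1 + x) := Real.log_pos (by linarith)
  have hx1 : (1 : ℝ) + x ≠ 0 := by positivity
  have he : r + (1 - r) / (1 + x) = (1 + r * x) / (1 + x) := by field_simp; ring
  rw [fReal, if_neg hx.ne', he, Real.log_div (by positivity) hx1]
  field_simp
  ring

/-! ### Endpoint limits of the density and the integral from z = i -/

theorem tendsto_sigma_one {r : ℝ} (h0 : 0 < r) (h1 : r < 1) :
    Tendsto (sigma r) (𝓝[>] 1) (𝓝 0) := by
  have hnum : Tendsto (fun t : ℝ => -Real.log (1 - r * t)) (𝓝[>] 1)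
      (𝓝 (-Real.log (1 - r * 1))) := by
    refine Tendsto.mono_left ?_ nhdsWithin_le_nhds
    exact (((by fun_prop : Continuous fun t : ℝ => 1 - r * t).tendsto 1).log (by linarith)).neg
  have hlog : Tendsto (fun t : ℝ => Real.log (t - 1)) (𝓝[>] 1) atBot := by
    refine Real.tendsto_log_nhdsGT_zero.comp (tendsto_nhdsWithin_iff.2 ⟨?_, ?_⟩)
    · refine Tendsto.mono_left ?_ nhdsWithin_le_nhds
      exact ((by fun_prop : Continuous fun x : ℝ => x - 1).tendsto' 1 0 (by norm_num))
    · filter_upwards [self_mem_nhdsWithin] with x hx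
      rw [mem_Ioi] at hx ⊢
      linarith
  have hsq : Tendsto (fun t : ℝ => Real.log (t - 1) ^ 2) (𝓝[>] 1) atTop := by
    simp_rw [sq]; exact hlog.atBot_mul_atBot₀ hlog
  have hden : Tendsto (fun t : ℝ => t * (Real.log (t - 1) ^ 2 + Real.pi ^ 2)) (𝓝[>] 1) atTop :=
    (tendsto_nhdsWithin_of_tendsto_nhds (tendsto_id (x := 𝓝 (1 : ℝ)))).pos_mul_atTop one_pos
      (tendsto_atTop_add_const_right _ _ hsq)
  refine (EReal.tendsto_coe.2 (hnum.div_atTop hden)).congr' ?_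
  filter_upwards [Ioo_mem_nhdsGT (by rwa [lt_div_iff₀ h0, one_mul] : (1 : ℝ) < 1 / r)] with t ht
  rw [sigma, if_pos ht.2]

theorem tendsto_sigma_atTop {r : ℝ} (h0 : 0 < r) :
    Tendsto (sigma r) atTop (𝓝 0) := by
  have hπ := Real.pi_pos
  have hden : Tendsto (fun t : ℝ => t * (Real.log (t - 1) ^ 2 + Real.pi ^ 2)) atTop atTop := by
    refine tendsto_atTop_mono' _ ?_ (tendsto_id.atTop_mul_const (by positivity : 0 < Real.pi ^ 2))
    filter_upwards [eventually_ge_atTop 0] with t ht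
    exact mul_le_mul_of_nonneg_left (by linarith [sq_nonneg (Real.log (t - 1))]) ht
  have hinv : Tendsto (fun t : ℝ => t⁻¹) atTop (𝓝 0) := tendsto_inv_atTop_zero
  have hq : Tendsto (fun t : ℝ => (1 - t⁻¹) / (r - t⁻¹)) atTop (𝓝 ((1 - 0) / (r - 0))) :=
    (hinv.const_sub 1).div (hinv.const_sub r) (by simpa using h0.ne')
  have hnum := hq.log (by simpa using h0.ne')
  refine (EReal.tendsto_coe.2 (hnum.div_atTop hden)).congr' ?_
  filter_upwards [eventually_gt_atTop (1 / r), eventually_gt_atTop 0] with t ht ht0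
  have he : (t - 1) / (r * t - 1) = (1 - t⁻¹) / (r - t⁻¹) := by
    rw [← mul_div_mul_left (1 - t⁻¹) (r - t⁻¹) ht0.ne', mul_sub, mul_sub,
      mul_inv_cancel₀ ht0.ne', mul_one, mul_comm t r]
  rw [sigma, if_neg ht.not_gt, if_neg ht.ne', he]

theorem I_mem_cutPlane : Complex.I ∈ cutPlane := by
  rw [mem_cutPlane_iff, Complex.mem_slitPlane_iff]; simp

theorem integrableOn_sigma_div_one_add_sq {r : ℝ} (h0 : 0 < r) (h1 : r < 1) :
    IntegrableOn (fun t : ℝ => (sigma r t).toReal / (1 + t ^ 2)) (Ioi 1) := by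
  have hm := (measurable_sigma r).ereal_toReal
  refine Integrable.mono (integrableOn_sigma h0 h1)
    (hm.div (by fun_prop : Measurable fun t : ℝ => 1 + t ^ 2)).aestronglyMeasurable
    (Eventually.of_forall fun t => ?_)
  rw [norm_div]
  refine div_le_self (norm_nonneg _) ?_
  rw [Real.norm_of_nonneg (by positivity)]
  nlinarith [sq_nonneg t]

theorem log_one_add_ofReal_mul_I (s : ℝ) :
    Complex.log (1 + s * Complex.I) =
      (Real.log (1 + s ^ 2) / 2 : ℝ) + (Real.arctan s : ℝ) * Complex.I := by
  have hn : ‖(1 + s * Complex.I : ℂ)‖ = √(1 + s ^ 2) := by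
    have := Complex.norm_add_mul_I 1 s
    simpa using this
  apply Complex.ext
  · rw [Complex.log_re, hn, Real.log_sqrt (by positivity)]
    simp [-Complex.ofReal_arctan]
  · rw [Complex.log_im, Complex.arg_of_re_nonneg (by simp), hn, Real.arctan_eq_arcsin]
    simp

theorem integral_sigma_div_one_add_sq {r : ℝ} (h0 : 0 < r) (h1 : r < 1) :
    (∫ t in Ioi (1 : ℝ), (sigma r t).toReal / (1 + t ^ 2)) =
      (Real.log 2 * Real.log (1 + r ^ 2) + Real.pi * Real.arctan r) /
        (Real.log 2 ^ 2 + Real.pi ^ 2 / 4) - r := by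
  have h := fCut_eq h0 h1 I_mem_cutPlane
  have hint := integrableOn_div_add_mul_sigma h0 h1 I_mem_cutPlane
  have hre := integral_re hint
  -- Since i/(i + t) = (1 + it)/(1 + t²), the integral sought is the real part of the representation
  -- at z = i.
  have hcongr : ∀ t : ℝ, RCLike.re (Complex.I / (Complex.I + (t : ℂ)) * ((sigma r t).toReal : ℂ)) =
      (sigma r t).toReal / (1 + t ^ 2) := by
    intro t
    simp [Complex.div_re, Complex.normSq_apply]
    ring
  simp only [hcongr] at hre
  have hlog2 := log_one_add_ofReal_mul_I 1
  have hlogr := log_one_add_ofReal_mul_I r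
  rw [Complex.ofReal_one, one_mul, Real.arctan_one] at hlog2
  rw [fCut, if_neg Complex.I_ne_zero, hlogr, hlog2] at h
  have h2 := congrArg Complex.re h
  rw [Complex.add_re, Complex.ofReal_re] at h2
  have hre' : (∫ t in Ioi (1 : ℝ), (sigma r t).toReal / (1 + t ^ 2)) =
    (∫ t in Ioi (1 : ℝ), Complex.I / (Complex.I + (t : ℂ)) * ((sigma r t).toReal : ℂ)).re := hre
  rw [hre', ← sub_eq_iff_eq_add'.2 h2, Complex.div_re, Complex.normSq_add_mul_I]
  simp only [Complex.add_re, Complex.add_im, Complex.ofReal_re, Complex.ofReal_im, Complex.mul_re,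
    Complex.mul_im, Complex.I_re, Complex.I_im]
  have hl := Real.log_pos one_lt_two
  have hπ := Real.pi_pos
  have h12 : (1 : ℝ) + 1 ^ 2 = 2 := by norm_num
  rw [h12]
  congr 1
  have hd1 : (Real.log 2 / 2) ^ 2 + (Real.pi / 4) ^ 2 = (Real.log 2 ^ 2 + Real.pi ^ 2 / 4) / 4 := by
    ring
  have hd2 : Real.log 2 ^ 2 + Real.pi ^ 2 / 4 ≠ 0 := by positivity
  rw [hd1, ← add_div, div_eq_div_iff (by positivity) hd2]
  ring

/-! ### Stieltjes measures and the complete Bernstein property -/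

section WithDensity

variable {α E : Type*} [MeasurableSpace α] {μ : Measure α} [NormedAddCommGroup E] [NormedSpace ℝ E]

theorem integrable_withDensity_ofReal_iff {w : α → ℝ} (hw : AEMeasurable w μ)
    (h0 : ∀ᵐ a ∂μ, 0 ≤ w a) {g : α → E} :
    Integrable g (μ.withDensity fun a => ENNReal.ofReal (w a)) ↔
      Integrable (fun a => w a • g a) μ := by
  rw [integrable_withDensity_iff_integrable_smul₀' hw.ennreal_ofReal (by simp)]
  refine integrable_congr ?_
  filter_upwards [h0] with a ha
  rw [ENNReal.toReal_ofReal ha]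

theorem integral_withDensity_ofReal_eq {w : α → ℝ} (hw : AEMeasurable w μ)
    (h0 : ∀ᵐ a ∂μ, 0 ≤ w a) (g : α → E) :
    ∫ a, g a ∂(μ.withDensity fun a => ENNReal.ofReal (w a)) = ∫ a, w a • g a ∂μ := by
  rw [integral_withDensity_eq_integral_toReal_smul₀ hw.ennreal_ofReal (by simp)]
  refine integral_congr_ae ?_
  filter_upwards [h0] with a ha
  rw [ENNReal.toReal_ofReal ha]

end WithDensity

/-- The Laplace transform of a positive measure on `[0,∞)` is completely monotone. -/
theorem isCompletelyMonotone_laplace {ν : Measure ℝ} (hν : ∀ᵐ t ∂ν, 0 ≤ t)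
    (hint : ∀ x : ℝ, 0 < x → Integrable (fun t => Real.exp (-(x * t))) ν) :
    IsCompletelyMonotone fun x => ∫ t, Real.exp (-(x * t)) ∂ν := by
  -- As a moment generating function at -x, the transform is analytic, and its n-th derivative
  -- carries the factor (-t)^n.
  have hfun : (fun x => ∫ t, Real.exp (-(x * t)) ∂ν) =
      fun x => ProbabilityTheory.mgf id ν (-x) := by
    ext x
    simp [ProbabilityTheory.mgf]
  have hsub : Iio 0 ⊆ interior (ProbabilityTheory.integrableExpSet id ν) := by
    refine interior_maximal (fun x hx => ?_) isOpen_Iio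
    have := hint (-x) (neg_pos.2 hx)
    simpa [ProbabilityTheory.integrableExpSet] using this
  rw [hfun]
  constructor
  · have h1 : ContDiffOn ℝ ∞ (ProbabilityTheory.mgf id ν) (Iio 0) :=
      (ProbabilityTheory.analyticOnNhd_mgf.mono hsub).contDiffOn isOpen_Iio.uniqueDiffOn
    exact h1.comp contDiff_neg.contDiffOn fun x hx => by simpa using hx
  · intro n x hx
    rw [iteratedDeriv_comp_neg,
      ProbabilityTheory.iteratedDeriv_mgf (hsub (by simpa using hx)), smul_eq_mul, ← mul_assoc,
      ← mul_pow, neg_one_mul, neg_neg, one_pow, one_mul]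
    refine integral_nonneg_of_ae ?_
    filter_upwards [hν] with t ht
    have : 0 ≤ t ^ n := pow_nonneg ht n
    simp only [Pi.zero_apply, id]
    positivity

/-- The Stieltjes measure of `1 - f_r`. -/
noncomputable def mulSigmaMeasure (r : ℝ) : Measure ℝ :=
  (volume.restrict (Ioi 1)).withDensity fun t => ENNReal.ofReal (t * (sigma r t).toReal)

theorem aemeasurable_mul_sigma (r : ℝ) :
    AEMeasurable (fun t => t * (sigma r t).toReal) (volume.restrict (Ioi 1)) :=
  (measurable_id.mul (measurable_sigma r).ereal_toReal).aemeasurable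

theorem ae_mul_sigma_nonneg {r : ℝ} (h0 : 0 < r) (h1 : r < 1) :
    ∀ᵐ t ∂volume.restrict (Ioi 1), 0 ≤ t * (sigma r t).toReal := by
  filter_upwards [ae_restrict_mem measurableSet_Ioi] with t ht
  have ht1 : (1 : ℝ) < t := ht
  exact mul_nonneg (by linarith) (toReal_sigma_nonneg h0 h1 ht)

theorem ae_mulSigmaMeasure (r : ℝ) : ∀ᵐ t ∂mulSigmaMeasure r, 1 < t :=
  (withDensity_absolutelyContinuous _ _).ae_le (ae_restrict_mem measurableSet_Ioi)

instance sFinite_mulSigmaMeasure (r : ℝ) : SFinite (mulSigmaMeasure r) := by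
  unfold mulSigmaMeasure; infer_instance

theorem integrable_one_div_add_mulSigmaMeasure {r : ℝ} (h0 : 0 < r) (h1 : r < 1) {x : ℝ}
    (hx : -1 < x) : Integrable (fun t => 1 / (x + t)) (mulSigmaMeasure r) := by
  rw [mulSigmaMeasure, integrable_withDensity_ofReal_iff (aemeasurable_mul_sigma r)
    (ae_mul_sigma_nonneg h0 h1)]
  refine (integrableOn_real_mul_sigma_div h0 h1 hx).congr (Eventually.of_forall fun t => ?_)
  simp only [smul_eq_mul]; ring

theorem integral_one_div_add_mulSigmaMeasure {r : ℝ} (h0 : 0 < r) (h1 : r < 1) {x : ℝ}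
    (hx : -1 < x) : ∫ t, 1 / (x + t) ∂mulSigmaMeasure r = 1 - fReal r x := by
  rw [one_sub_fReal_eq h0 h1 hx, mulSigmaMeasure,
    integral_withDensity_ofReal_eq (aemeasurable_mul_sigma r) (ae_mul_sigma_nonneg h0 h1)]
  congr 1 with t
  simp only [smul_eq_mul]; ring

theorem isStieltjes_one_sub_fReal {r : ℝ} (h0 : 0 < r) (h1 : r < 1) :
    IsStieltjes fun x => 1 - fReal r x := by
  refine ⟨0, mulSigmaMeasure r, le_rfl, fun x hx => ?_⟩
  have hr : (mulSigmaMeasure r).restrict (Ici 0) = mulSigmaMeasure r :=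
    Measure.restrict_eq_self_of_ae_mem ((ae_mulSigmaMeasure r).mono fun t ht => by
      rw [mem_Ici]; linarith)
  rw [IntegrableOn, hr, integral_one_div_add_mulSigmaMeasure h0 h1 (by linarith), zero_add]
  exact ⟨integrable_one_div_add_mulSigmaMeasure h0 h1 (by linarith), rfl⟩

theorem sigma_ne_top {r t : ℝ} (h : t ≠ 1 / r) : sigma r t ≠ ⊤ := by
  unfold sigma
  rw [if_neg h]
  split_ifs <;> exact EReal.coe_ne_top _

theorem muMeasure_restrict_Ici (r : ℝ) : (muMeasure r).restrict (Ici 0) = muMeasure r := by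
  refine Measure.restrict_eq_self_of_ae_mem ?_
  rw [muMeasure, ae_add_measure_iff]
  constructor
  · refine Measure.smul_absolutelyContinuous.ae_le ?_
    rw [ae_dirac_eq]
    simp
  · refine (withDensity_absolutelyContinuous _ _).ae_le ?_
    filter_upwards [ae_restrict_mem measurableSet_Ioi] with t ht
    have ht1 : (1 : ℝ) < t := ht
    rw [mem_Ici]; linarith

theorem muMeasure_integral {E : Type*} [NormedAddCommGroup E] [NormedSpace ℝ E] [CompleteSpace E]
    {r : ℝ} (h0 : 0 < r) (h1 : r < 1) {g : ℝ → E}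
    (hg : IntegrableOn (fun t => (sigma r t).toReal • g t) (Ioi 1)) :
    IntegrableOn g (Ici 0) (muMeasure r) ∧
      ∫ t in Ici 0, g t ∂muMeasure r = r • g 0 + ∫ t in Ioi 1, (sigma r t).toReal • g t := by
  have hm : Measurable fun t => (sigma r t).toENNReal := (measurable_sigma r).ereal_toENNReal
  have hfin : ∀ᵐ t ∂volume.restrict (Ioi (1 : ℝ)), (sigma r t).toENNReal < ⊤ := by
    filter_upwards [ae_restrict_of_ae (Measure.ae_ne volume (1 / r))] with t ht
    exact (EReal.toENNReal_ne_top_iff.2 (sigma_ne_top ht)).lt_top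
  have hcongr : (fun t => (sigma r t).toENNReal.toReal • g t) =ᵐ[volume.restrict (Ioi (1 : ℝ))]
      fun t => (sigma r t).toReal • g t := by
    filter_upwards [ae_restrict_mem measurableSet_Ioi] with t ht
    rw [EReal.toReal_toENNReal (sigma_nonneg h0 h1 ht)]
  have hd : Integrable g (ENNReal.ofReal r • Measure.dirac (0 : ℝ)) :=
    (integrable_dirac (by simp)).smul_measure ENNReal.ofReal_ne_top
  have hw : Integrable g
      ((volume.restrict (Ioi 1)).withDensity (fun t => (sigma r t).toENNReal)) :=
    (integrable_withDensity_iff_integrable_smul' hm hfin).2 (hg.congr hcongr.symm)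
  rw [IntegrableOn, muMeasure_restrict_Ici, muMeasure]
  refine ⟨hd.add_measure hw, ?_⟩
  rw [integral_add_measure hd hw, integral_smul_measure, integral_dirac,
    ENNReal.toReal_ofReal h0.le, integral_withDensity_eq_integral_toReal_smul hm hfin,
    integral_congr_ae hcongr]

/-- Dividing the representation of f_r by z turns the constant r into r/z, the contribution of the
atom at 0. -/
theorem muMeasure_representation {r : ℝ} (h0 : 0 < r) (h1 : r < 1) {z : ℂ} (hz : z ∈ cutPlane)
    (hz0 : z ≠ 0) :
    IntegrableOn (fun t : ℝ => 1 / (z + (t : ℂ))) (Ici 0) (muMeasure r) ∧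
      fCut r z / z = ∫ t in Ici (0 : ℝ), 1 / (z + (t : ℂ)) ∂(muMeasure r) := by
  have heq : ∀ t : ℝ, (sigma r t).toReal • (1 / (z + (t : ℂ))) =
      z⁻¹ * (z / (z + (t : ℂ)) * ((sigma r t).toReal : ℂ)) := by
    intro t
    rw [Complex.real_smul]
    field_simp
  have hi : IntegrableOn (fun t : ℝ => (sigma r t).toReal • (1 / (z + (t : ℂ)))) (Ioi 1) := by
    simp_rw [heq]
    exact (integrableOn_div_add_mul_sigma h0 h1 hz).const_mul _
  obtain ⟨h2, h3⟩ := muMeasure_integral h0 h1 hi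
  refine ⟨h2, ?_⟩
  rw [h3]
  simp_rw [heq]
  rw [integral_const_mul, fCut_eq h0 h1 hz, Complex.real_smul]
  simp
  field_simp

theorem isStieltjes_fReal_div {r : ℝ} (h0 : 0 < r) (h1 : r < 1) :
    IsStieltjes fun x => fReal r x / x := by
  refine ⟨0, muMeasure r, le_rfl, fun x hx => ?_⟩
  have hx1 : -1 < x := by linarith
  obtain ⟨h2, h3⟩ := muMeasure_representation h0 h1 (ofReal_mem_cutPlane hx1)
    (by exact_mod_cast hx.ne')
  have hcast : (fun t : ℝ => 1 / ((x : ℂ) + (t : ℂ))) = fun t => ((1 / (x + t) : ℝ) : ℂ) := by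
    ext t; push_cast; rfl
  rw [hcast] at h2 h3
  rw [fCut_ofReal h0 h1 hx1, integral_complex_ofReal] at h3
  refine ⟨?_, ?_⟩
  · exact h2.re
  · rw [zero_add]; exact_mod_cast h3

/-- The density of the Lévy measure of `f_r`. -/
noncomputable def levyDensity (r s : ℝ) : ℝ := ∫ t, Real.exp (-(s * t)) ∂mulSigmaMeasure r

theorem integrable_exp_mulSigmaMeasure {r : ℝ} (h0 : 0 < r) (h1 : r < 1) {x : ℝ} (hx : 0 < x) :
    Integrable (fun t => Real.exp (-(x * t))) (mulSigmaMeasure r) := by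
  -- The bound exp(-u) ≤ 1/u with u = xt reduces to the Stieltjes integral at the point 0.
  refine Integrable.mono' ((integrable_one_div_add_mulSigmaMeasure h0 h1
    (by norm_num : (-1 : ℝ) < 0)).const_mul x⁻¹) (by fun_prop) ?_
  filter_upwards [ae_mulSigmaMeasure r] with t ht
  have hxt : 0 < x * t := mul_pos hx (by linarith)
  rw [Real.norm_of_nonneg (Real.exp_pos _).le, Real.exp_neg, zero_add, one_div, ← mul_inv]
  refine inv_anti₀ hxt ?_
  linarith [Real.add_one_le_exp (x * t)]

theorem isCompletelyMonotone_levyDensity {r : ℝ} (h0 : 0 < r) (h1 : r < 1) :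
    IsCompletelyMonotone (levyDensity r) :=
  isCompletelyMonotone_laplace ((ae_mulSigmaMeasure r).mono fun t ht => by linarith)
    fun _ hx => integrable_exp_mulSigmaMeasure h0 h1 hx

theorem levyDensity_nonneg (r s : ℝ) : 0 ≤ levyDensity r s :=
  integral_nonneg fun _ => (Real.exp_pos _).le

/-- Fubini with ∫ exp(-(x + t)s) ds = 1/(x + t). Allowing x = 0 yields the finite total mass of the
Lévy density. -/
theorem laplace_levyDensity {r : ℝ} (h0 : 0 < r) (h1 : r < 1) {x : ℝ} (hx : 0 ≤ x) :
    IntegrableOn (fun s => Real.exp (-(x * s)) * levyDensity r s) (Ioi 0) ∧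
      ∫ s in Ioi 0, Real.exp (-(x * s)) * levyDensity r s = 1 - fReal r x := by
  have hsplit : ∀ s t : ℝ, Real.exp (-(x * s)) * Real.exp (-(s * t)) = Real.exp (-(x + t) * s) := by
    intro s t
    rw [← Real.exp_add]; congr 1; ring
  have hinner : ∀ t : ℝ, 1 < t → ∫ s in Ioi 0, Real.exp (-(x + t) * s) = 1 / (x + t) := by
    intro t ht
    rw [integral_exp_mul_Ioi (by linarith)]
    rw [mul_zero, Real.exp_zero, neg_div_neg_eq]
  have hprod : Integrable (fun p : ℝ × ℝ => Real.exp (-(x + p.2) * p.1))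
      ((volume.restrict (Ioi 0)).prod (mulSigmaMeasure r)) := by
    rw [integrable_prod_iff' (by fun_prop)]
    constructor
    · filter_upwards [ae_mulSigmaMeasure r] with t ht
      exact integrableOn_exp_mul_Ioi (by linarith) 0
    · refine (integrable_one_div_add_mulSigmaMeasure h0 h1 (by linarith : -1 < x)).congr ?_
      filter_upwards [ae_mulSigmaMeasure r] with t ht
      simp only [Real.norm_of_nonneg (Real.exp_pos _).le]
      exact (hinner t ht).symm
  have heq : ∀ s : ℝ, Real.exp (-(x * s)) * levyDensity r s =
      ∫ t, Real.exp (-(x + t) * s) ∂mulSigmaMeasure r := by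
    intro s
    rw [levyDensity, ← integral_const_mul]
    simp_rw [hsplit]
  simp_rw [heq]
  refine ⟨hprod.integral_prod_left, ?_⟩
  rw [integral_integral_swap hprod, ← integral_one_div_add_mulSigmaMeasure h0 h1 (by linarith)]
  refine integral_congr_ae ?_
  filter_upwards [ae_mulSigmaMeasure r] with t ht
  exact hinner t ht

theorem integrableOn_levyDensity {r : ℝ} (h0 : 0 < r) (h1 : r < 1) :
    IntegrableOn (levyDensity r) (Ioi 0) := by
  simpa using (laplace_levyDensity h0 h1 le_rfl).1

theorem integral_levyDensity {r : ℝ} (h0 : 0 < r) (h1 : r < 1) :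
    ∫ s in Ioi 0, levyDensity r s = 1 - r := by
  have := (laplace_levyDensity h0 h1 le_rfl).2
  simpa [fReal] using this

/-- On (0, ∞), f_r is 1 minus the Laplace transform of the Lévy density; complete monotonicity of
the latter gives the derivative signs. -/
theorem isBernstein_fReal {r : ℝ} (h0 : 0 < r) (h1 : r < 1) : IsBernstein (fReal r) := by
  have hm := (integrableOn_levyDensity h0 h1).aemeasurable
  have hnn : ∀ᵐ s ∂volume.restrict (Ioi 0), 0 ≤ levyDensity r s :=
    Eventually.of_forall (levyDensity_nonneg r)
  have hcm : IsCompletelyMonotone fun x => ∫ s, Real.exp (-(x * s))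
      ∂((volume.restrict (Ioi 0)).withDensity fun s => ENNReal.ofReal (levyDensity r s)) := by
    refine isCompletelyMonotone_laplace ?_ fun x hx => ?_
    · refine (withDensity_absolutelyContinuous _ _).ae_le ?_
      filter_upwards [ae_restrict_mem measurableSet_Ioi] with s hs using le_of_lt hs
    · rw [integrable_withDensity_ofReal_iff hm hnn]
      simpa [mul_comm, IntegrableOn] using (laplace_levyDensity h0 h1 hx.le).1
  set G : ℝ → ℝ := fun x => ∫ s, Real.exp (-(x * s))
      ∂((volume.restrict (Ioi 0)).withDensity fun s => ENNReal.ofReal (levyDensity r s)) with hG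
  have hfG : EqOn (fReal r) (fun x => 1 - G x) (Ioi 0) := by
    intro x hx
    have := (laplace_levyDensity h0 h1 (le_of_lt hx)).2
    simp only [hG]
    rw [integral_withDensity_ofReal_eq hm hnn]
    simp_rw [smul_eq_mul, mul_comm (levyDensity r _)]
    rw [this]; ring
  refine ⟨(contDiffOn_const.sub hcm.1).congr hfG, fun x hx => ?_, fun n hn x hx => ?_⟩
  · rw [fReal, if_neg hx.ne']
    have : 0 < r * x := by positivity
    exact div_nonneg (Real.log_nonneg (by linarith)) (Real.log_nonneg (by linarith))
  · rw [Filter.EventuallyEq.iteratedDeriv_eq n (hfG.eventuallyEq_of_mem (Ioi_mem_nhds hx)),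
      iteratedDeriv_const_sub hn, iteratedDeriv_neg]
    obtain ⟨k, rfl⟩ := Nat.exists_eq_add_of_le' hn
    have := hcm.2 (k + 1) x hx
    rw [pow_succ] at this
    simpa using this

/-- With a = r and b = 0 the right-hand side is r + (1 - r) - (1 - f_r(x)). -/
theorem isCompleteBernstein_fReal {r : ℝ} (h0 : 0 < r) (h1 : r < 1) :
    IsCompleteBernstein (fReal r) := by
  refine ⟨isBernstein_fReal h0 h1, r, 0, levyDensity r, h0.le, le_rfl,
    isCompletelyMonotone_levyDensity h0 h1, ?_, fun x hx => ?_⟩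
  · refine Integrable.bdd_mul (c := 1) (integrableOn_levyDensity h0 h1) (by fun_prop) ?_
    filter_upwards [ae_restrict_mem measurableSet_Ioi] with s hs
    have hs0 : (0 : ℝ) < s := hs
    rw [Real.norm_of_nonneg (by positivity)]
    exact min_le_left _ _
  · obtain ⟨hi, he⟩ := laplace_levyDensity h0 h1 hx.le
    simp_rw [sub_mul, one_mul]
    rw [integral_sub (integrableOn_levyDensity h0 h1) hi, he, integral_levyDensity h0 h1]
    ring

theorem theorem2 (r : ℝ) (hr0 : 0 < r) (hr1 : r < 1) :
    -- `f_r` is a complete Bernstein function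
    IsCompleteBernstein (fReal r) ∧
    -- the density is non-negative
    (∀ t : ℝ, 1 < t → 0 ≤ sigma r t) ∧
    -- the integral representation in the cut plane
    (∀ z ∈ cutPlane,
      IntegrableOn (fun t : ℝ => z / (z + (t : ℂ)) * ((sigma r t).toReal : ℂ)) (Ioi 1) ∧
      fCut r z = (r : ℂ) +
        ∫ t in Ioi (1 : ℝ), z / (z + (t : ℂ)) * ((sigma r t).toReal : ℂ)) ∧
    -- strictly concave, strictly increasing from `0` to `1` on `(-1,∞)`
    StrictConcaveOn ℝ (Ioi (-1)) (fReal r) ∧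
    StrictMonoOn (fReal r) (Ioi (-1)) ∧
    Tendsto (fReal r) (𝓝[>] (-1)) (𝓝 0) ∧
    Tendsto (fReal r) atTop (𝓝 1) ∧
    -- `1 - f_r` is a Stieltjes function, with its representation
    IsStieltjes (fun x => 1 - fReal r x) ∧
    (∀ z ∈ cutPlane,
      IntegrableOn (fun t : ℝ => (t : ℂ) * ((sigma r t).toReal : ℂ) / (z + (t : ℂ))) (Ioi 1) ∧
      1 - fCut r z =
        ∫ t in Ioi (1 : ℝ), (t : ℂ) * ((sigma r t).toReal : ℂ) / (z + (t : ℂ))) ∧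
    -- `f_r(z)/z` is a Stieltjes function, with its representation
    IsStieltjes (fun x => fReal r x / x) ∧
    (∀ z ∈ cutPlane, z ≠ 0 →
      IntegrableOn (fun t : ℝ => 1 / (z + (t : ℂ))) (Ici 0) (muMeasure r) ∧
      fCut r z / z = ∫ t in Ici (0 : ℝ), 1 / (z + (t : ℂ)) ∂(muMeasure r)) ∧
    -- boundary behaviour of the density
    Tendsto (sigma r) (𝓝[>] 1) (𝓝 0) ∧
    Tendsto (sigma r) atTop (𝓝 0) ∧
    -- the two explicit integrals
    IntegrableOn (fun t : ℝ => (sigma r t).toReal) (Ioi 1) ∧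
    (∫ t in Ioi (1 : ℝ), (sigma r t).toReal) = 1 - r ∧
    IntegrableOn (fun t : ℝ => (sigma r t).toReal / (1 + t ^ 2)) (Ioi 1) ∧
    (∫ t in Ioi (1 : ℝ), (sigma r t).toReal / (1 + t ^ 2)) =
      (Real.log 2 * Real.log (1 + r ^ 2) + Real.pi * Real.arctan r) /
        (Real.log 2 ^ 2 + Real.pi ^ 2 / 4) - r := by
  exact ⟨isCompleteBernstein_fReal hr0 hr1, fun _ ht => sigma_nonneg hr0 hr1 ht,
    fun _ hz => ⟨integrableOn_div_add_mul_sigma hr0 hr1 hz, fCut_eq hr0 hr1 hz⟩,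
    strictConcaveOn_fReal hr0 hr1, strictMonoOn_fReal hr0 hr1, tendsto_fReal_neg_one hr1,
    tendsto_fReal_atTop hr0, isStieltjes_one_sub_fReal hr0 hr1,
    fun _ hz => ⟨integrableOn_mul_sigma_div hr0 hr1 hz, one_sub_fCut_eq hr0 hr1 hz⟩,
    isStieltjes_fReal_div hr0 hr1, fun _ hz hz0 => muMeasure_representation hr0 hr1 hz hz0,
    tendsto_sigma_one hr0 hr1, tendsto_sigma_atTop hr0, integrableOn_sigma hr0 hr1,
    integral_sigma hr0 hr1, integrableOn_sigma_div_one_add_sq hr0 hr1,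
    integral_sigma_div_one_add_sq hr0 hr1⟩
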